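/- Let $G=\frac1n\sum_{i=1}^nG_i$ with $n\ge1$ and $G_i:\mathbb R^p\to\mathbb R^p$, let $\mathrm{zer}\,G=\{x: Gx=0\}\neq\emptyset$, and let $\beta,\bar\beta\ge0$ be such that $$\langle Gx-Gy,x-y\rangle\ \ge\ \beta\|Gx-Gy\|^2+\frac{\bar\beta}{n}\sum_{i=1}^n\|G_ix-G_iy\|^2\qquad\text{for all }x,y\in\mathbb R^p .$$ Let $0<\gamma\le1$, $s\ge1+3\gamma$, let $\tau\ge1$ be an integer, $\Lambda:=1+s-\gamma$, and $$\bar\eta:=\frac{3\bar\beta}{7\Lambda\tau}\ \text{ if }\ 0<\bar\beta\le\frac{7\Lambda\tau\beta}{3(1+\tau)},\qquad \bar\eta:=\frac{\beta}{1+\tau}\ \text{ if }\ \bar\beta\ge\frac{7\Lambda\tau\beta}{3(1+\tau)}$$ ($\bar\eta:=0$ if $\bar\beta=0$). Let $0<\eta\le\bar\eta$, $t_k:=k+3s+\tau$ and $\eta_k:=\frac{\eta t_k}{2(t_k-s)}$. From a deterministic point $y^0=z^0\in\mathbb R^p$ generate the accelerated fixed-point method (AFP): for $k\ge0$, $$x^{k+1}=y^k-\eta_k\widetilde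 G^k,\qquad z^{k+1}=z^k+\frac{\gamma}{s}(x^{k+1}-y^k),\qquad y^{k+1}=\frac{t_k-s}{t_k}x^{k+1}+\frac{s}{t_k}z^{k+1},$$ with the inconsistent asynchronous estimator $\widetilde G^k=\frac1n\sum_{i=1}^nG_iy^{k-\tau_{i,k}}$, where the delays $\tau_{i,k}$ are arbitrary (possibly dependent) random variables on a probability space with values in $\{0,\dots,\tau\}$, and $y^{-j}:=y^0$ for $j\ge 0$. Then: (i) For every $x^\star\in\mathrm{zer}\,G$ and every $k\ge0$, with $\mathcal R_0^2:=\frac{\eta(3s+\tau-1)^2}{2}\|Gy^0\|^2+\frac{2s^3}{\eta\gamma}\|y^0-x^\star\|^2$, $$\mathbb E\|Gy^k\|^2\le\frac{4\mathcal R_0^2}{\eta(k+3s+\tau-1)^2},\qquad\text{and}\qquad \lim_{k\to\infty}(k+\tau)^2\,\mathbb E\|Gy^k\|^2=0 .$$ (ii) Almost surely $\sum_{k\ge0}(k+\tau)\|Gy^k\|^2<\infty$ and $\lim_{k\to\infty}(k+\tau)^2\|Gy^k\|^2=0$, and the sequences $\{x^k\},\{y^k\},\{z^k\}$ converge almost surely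 to one and the same $\mathrm{zer}\,G$-valued random variable. (iii) There is a constant $C>0$ depending only on $s$ and $\gamma$ such that, if $\eta=\bar\eta$, $x^\star\in\mathrm{zer}\,G$ and $R\ge\max\{\|Gy^0\|,\|y^0-x^\star\|\}$, then for every $\epsilon>0$ there is an integer $N\ge 0$ with $\mathbb E\|Gy^k\|^2\le\epsilon^2$ for all $k\ge N$ and $$N\le CR\Big(\frac{\tau}{\epsilon}+\frac{\tau}{\bar\beta\epsilon}\Big)\ \text{ if }\ 0<\bar\beta\le\frac{7\Lambda\tau\beta}{3(1+\tau)},\qquad N\le CR\Big(\frac{\tau}{\epsilon}+\frac{\tau}{\beta\epsilon}\Big)\ \text{ if }\ \bar\beta\ge\frac{7\Lambda\tau\beta}{3(1+\tau)} .$$ The same conclusions hold for the two aggregated schemes in which $\widetilde G^k=\frac1n\sum_i\hat G_i^k$ is the average of a memory that starts from $\hat G^0_i=G_iy^0$ and in which, at iteration $k$, one entry $i$ is replaced by $G_iy^k$: with $\tau=n$ for the incremental scheme, where $i$ runs cyclically through $1,\dots,n$, and with $\tau=2n$ for the shuffling scheme, where in each epoch of $n$ iterations $i$ runs through $1,\dots,n$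 in the order of a (deterministic or random) permutation chosen for that epoch. -/

import Mathlib

open MeasureTheory Filter Topology
open scoped BigOperators

noncomputable section

/-- The finite-sum operator `G x = (1/n) ∑ i, G i x` on `ℝ^p`. -/
def avgOp {n p : ℕ} (G : Fin n → EuclideanSpace ℝ (Fin p) → EuclideanSpace ℝ (Fin p))
    (x : EuclideanSpace ℝ (Fin p)) : EuclideanSpace ℝ (Fin p) :=
  (1 / (n : ℝ)) • ∑ i, G i x

/-- The co-coercivity condition
`⟪G x - G y, x - y⟫ ≥ β ‖G x - G y‖² + (β' / n) ∑ i, ‖G i x - G i y‖²`. -/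
def AvgCocoercive {n p : ℕ}
    (G : Fin n → EuclideanSpace ℝ (Fin p) → EuclideanSpace ℝ (Fin p)) (β β' : ℝ) : Prop :=
  ∀ x y : EuclideanSpace ℝ (Fin p),
    β * ‖avgOp G x - avgOp G y‖ ^ 2 + β' / n * ∑ i, ‖G i x - G i y‖ ^ 2
      ≤ inner ℝ (avgOp G x - avgOp G y) (x - y)

/-- `t_k = k + 3 s + τ`. -/
def tPar (s : ℝ) (τ k : ℕ) : ℝ := k + 3 * s + τ

/-- `η_k = η t_k / (2 (t_k - s))`. -/
def etaPar (s η : ℝ) (τ k : ℕ) : ℝ := η * tPar s τ k / (2 * (tPar s τ k - s))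

/-- `Λ = 1 + s - γ`. -/
def LambdaPar (s γ : ℝ) : ℝ := 1 + s - γ

/-- The value `7 Λ τ β / (3 (1 + τ))` of `β'` at which the two stepsize regimes meet. -/
def threshold (s γ β : ℝ) (τ : ℕ) : ℝ := 7 * LambdaPar s γ * τ * β / (3 * (1 + τ))

open Classical in
/-- The stepsize bound: `3 β' / (7 Λ τ)` if `β'` is at most the threshold, `β / (1 + τ)` if it is
at least the threshold (the two values agree at the threshold).
For `β' = 0` or `β = 0` it is `0`, so that no positive stepsize is admissible. -/
def etaBar (s γ β β' : ℝ) (τ : ℕ) : ℝ :=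
  if β' ≤ threshold s γ β τ then 3 * β' / (7 * LambdaPar s γ * τ) else β / (1 + τ)

/-- `R₀² = (η (3 s + τ - 1)² / 2) ‖G y⁰‖² + (2 s³ / (η γ)) ‖y⁰ - x⋆‖²`. -/
def initSq {n p : ℕ} (G : Fin n → EuclideanSpace ℝ (Fin p) → EuclideanSpace ℝ (Fin p))
    (s γ η : ℝ) (τ : ℕ) (y0 xs : EuclideanSpace ℝ (Fin p)) : ℝ :=
  η * (3 * s + τ - 1) ^ 2 / 2 * ‖avgOp G y0‖ ^ 2 + 2 * s ^ 3 / (η * γ) * ‖y0 - xs‖ ^ 2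

/-- The stochastic processes `x, y, z` are generated by the accelerated fixed-point method from
the deterministic point `y0`, with the estimators `Gt k` of `G (y k)` and with `γ_k = γ`.
The method does not use `x 0`. -/
structure IsAFP {Ω : Type*} {p : ℕ} (s γ η : ℝ) (τ : ℕ) (y0 : EuclideanSpace ℝ (Fin p))
    (Gt x y z : ℕ → Ω → EuclideanSpace ℝ (Fin p)) : Prop where
  y_zero : ∀ ω, y 0 ω = y0
  z_zero : ∀ ω, z 0 ω = y0
  x_succ : ∀ k ω, x (k + 1) ω = y k ω - etaPar s η τ k • Gt k ω
  z_succ : ∀ k ω, z (k + 1) ω = z k ω + (γ / s) • (x (k + 1) ω - y k ω)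
  y_succ : ∀ k ω, y (k + 1) ω =
    ((tPar s τ k - s) / tPar s τ k) • x (k + 1) ω + (s / tPar s τ k) • z (k + 1) ω

/-- Inconsistent asynchronous estimator: `Gt k = (1/n) ∑ i, G i (y (k - d i k))` with random
delays `d i k ∈ {0, …, τ}`, which may depend on each other and on the iterates in any way.
Truncated subtraction is the convention `y^{-j} = y^0`. -/
def IsInconsistentEstimator {Ω : Type*} [MeasurableSpace Ω] {n p : ℕ}
    (G : Fin n → EuclideanSpace ℝ (Fin p) → EuclideanSpace ℝ (Fin p)) (τ : ℕ)
    (y Gt : ℕ → Ω → EuclideanSpace ℝ (Fin p)) : Prop :=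
  ∃ d : Fin n → ℕ → Ω → ℕ,
    (∀ i k, Measurable (d i k)) ∧ (∀ i k ω, d i k ω ≤ τ) ∧
    ∀ k ω, Gt k ω = (1 / (n : ℝ)) • ∑ i, G i (y (k - d i k ω) ω)

/-- The memory of the aggregated schemes: it starts with the values `G i (y 0)`, and at iteration
`k` the entry of the active index `a k` is replaced by `G (a k) (y k)`. -/
def buffer {n p : ℕ} (G : Fin n → EuclideanSpace ℝ (Fin p) → EuclideanSpace ℝ (Fin p))
    (a : ℕ → Fin n) (y : ℕ → EuclideanSpace ℝ (Fin p)) : ℕ → Fin n → EuclideanSpace ℝ (Fin p)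
  | 0, i => G i (y 0)
  | k + 1, i => if i = a (k + 1) then G i (y (k + 1)) else buffer G a y k i

/-- Incremental aggregated estimator: the average of the memory, the active index running
cyclically through the components. -/
def IsIncrementalEstimator {Ω : Type*} {n p : ℕ} [NeZero n]
    (G : Fin n → EuclideanSpace ℝ (Fin p) → EuclideanSpace ℝ (Fin p))
    (y Gt : ℕ → Ω → EuclideanSpace ℝ (Fin p)) : Prop :=
  ∀ k ω, Gt k ω =
    (1 / (n : ℝ)) • ∑ i, buffer G (fun j => Fin.ofNat n j) (fun j => y j ω) k i

/-- Shuffling aggregated estimator: the average of the memory, the active index running in epoch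
`m` (iterations `m n, …, m n + n - 1`) through the components in the order prescribed by a
deterministic or random permutation `π m`. -/
def IsShufflingEstimator {Ω : Type*} [MeasurableSpace Ω] {n p : ℕ} [NeZero n]
    (G : Fin n → EuclideanSpace ℝ (Fin p) → EuclideanSpace ℝ (Fin p))
    (y Gt : ℕ → Ω → EuclideanSpace ℝ (Fin p)) : Prop :=
  ∃ π : ℕ → Ω → Equiv.Perm (Fin n),
    (∀ m i, Measurable fun ω => π m ω i) ∧
    ∀ k ω, Gt k ω =
      (1 / (n : ℝ)) •
        ∑ i, buffer G (fun j => π (j / n) ω (Fin.ofNat n j)) (fun j => y j ω) k i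

end

/-! The argument is deterministic and pathwise: it uses only that each component is evaluated at an
iterate at most `τ` steps old, so neither independence nor unbiasedness of the delays matters. After
scaling by `η`, write `w` for the residual, `v` for its estimator, `e = v - w`, `ζ = z - y`, and `D`
for the mean squared component increments.

The energy combines the weighted residual, a cross term `⟪w, ζ⟫` and the anchor distance `‖z -
x⋆‖²`, with weights shifted by `μ = α (3s + τ - 1)`, `α = 1 - 2γ/(s-1)`. Its one-step change is an
exact identity (`energy_balance`). Co-coercivity along `y (k+1) - y k` pays for the increments of
`w` and leaves a gain in `D`. Co-coercivity against `x⋆` and the decay of the shifted anchor weight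
pay, through Young's inequality, for the other cross terms (`energy_step`). What remains is a
multiple of `‖e‖²`, which is at most `τ` times a window of past `D`'s. A single step therefore need
not decrease the energy, but after summation and exchange of the order each `D (k+1)` is charged
with a window of weights that its own gain covers (`energy_add_sum_le`).

Positivity of the energy yields the `O(1/k²)` rate and the summability of `k ‖w k‖²` and `k² D
(k+1)`, hence of the weighted errors. These make `ζ` tend to zero (`tendsto_sub`) and `z`
quasi-Fejér with respect to every zero (`exists_tendsto_anchor`). Then the energy, the anchor
distance and the cross term all converge, so the weighted residual does too; since its quotients by
`k` are summable, its limit is zero. Opial's argument gives convergence of the iterates.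
Expectations follow by integrating the uniform pathwise bound and by dominated convergence. -/

/-! ### Scalar inequalities between the parameters. -/

/-- Parameter inequality behind the bound of the coupling of the estimation error with `z - x⋆`. -/
theorem error_budget {γ a α : ℝ} (h0 : 0 < γ) (h1 : γ ≤ 1) (ha : 3 * γ ≤ a)
    (hα : α * a = a - 2 * γ) :
    γ * (a + (1 + a) * α) ^ 2
      ≤ 2 * α * (1 + a) * (1 + α) * (2 * (a - γ) + 29 / 16 - γ / 8) := by
  -- Multiplying by `a²` eliminates `α`. In the nonnegative variables `γ`, `d = a - 3γ` and `h = 1 -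
  -- γ`, the gap is then a polynomial with positive coefficients.
  obtain ⟨d, hd, rfl⟩ : ∃ d, 0 ≤ d ∧ a = 3 * γ + d := ⟨a - 3 * γ, by linarith, by ring⟩
  obtain ⟨h, hh, hg⟩ : ∃ h, 0 ≤ h ∧ h = 1 - γ := ⟨1 - γ, by linarith, rfl⟩
  set a := 3 * γ + d with ha'
  have hapos : 0 < a := by positivity
  have key : γ * (2 * a ^ 2 + a - 2 * γ * a - 2 * γ) ^ 2
      ≤ 4 * (1 + a) * (a - 2 * γ) * (a - γ) * (2 * a + 29 / 16 - 17 / 8 * γ) := by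
    have : 4 * (1 + a) * (a - 2 * γ) * (a - γ) * (2 * a + 29 / 16 - 17 / 8 * γ)
        - γ * (2 * a ^ 2 + a - 2 * γ * a - 2 * γ) ^ 2
        = 8 * h * d ^ 4 + 61 / 4 * h ^ 2 * d ^ 3 + 29 / 4 * h ^ 3 * d ^ 2 + 4 * γ * d ^ 4
          + 90 * γ * h * d ^ 3 + 415 / 4 * γ * h ^ 2 * d ^ 2 + 87 / 4 * γ * h ^ 3 * d
          + 139 / 4 * γ ^ 2 * d ^ 3 + 1371 / 4 * γ ^ 2 * h * d ^ 2 + 411 / 2 * γ ^ 2 * h ^ 2 * d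
          + 29 / 2 * γ ^ 2 * h ^ 3 + 393 / 4 * γ ^ 3 * d ^ 2 + 2081 / 4 * γ ^ 3 * h * d
          + 117 * γ ^ 3 * h ^ 2 + 193 / 2 * γ ^ 4 * d + 519 / 2 * γ ^ 4 * h + 13 * γ ^ 5 := by
      rw [ha', hg]; ring
    have : 0 ≤ 4 * (1 + a) * (a - 2 * γ) * (a - γ) * (2 * a + 29 / 16 - 17 / 8 * γ)
        - γ * (2 * a ^ 2 + a - 2 * γ * a - 2 * γ) ^ 2 := by rw [this]; positivity
    linarith
  have e1 : a * (a + (1 + a) * α) = 2 * a ^ 2 + a - 2 * γ * a - 2 * γ := by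
    linear_combination (1 + a) * hα
  have e2 : a ^ 2 * (γ * (a + (1 + a) * α) ^ 2)
      = γ * (2 * a ^ 2 + a - 2 * γ * a - 2 * γ) ^ 2 := by rw [← e1]; ring
  have e3 : a ^ 2 * (2 * α * (1 + a) * (1 + α) * (2 * (a - γ) + 29 / 16 - γ / 8))
      = 4 * (1 + a) * (a - 2 * γ) * (a - γ) * (2 * a + 29 / 16 - 17 / 8 * γ) := by
    have : a ^ 2 * (2 * α * (1 + a) * (1 + α) * (2 * (a - γ) + 29 / 16 - γ / 8))
      = 2 * (1 + a) * (α * a) * (a + α * a) * (2 * (a - γ) + 29 / 16 - γ / 8) := by ring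
    rw [this, hα]; ring
  exact le_of_mul_le_mul_left (by rw [e2, e3]; exact key) (by positivity : 0 < a ^ 2)

/-- Parameter inequality behind the decrease of the weighted squared residual. -/
theorem residual_budget {γ a α τ : ℝ} (t : ℝ) (h0 : 0 < γ) (h1 : γ ≤ 1) (ha : 3 * γ ≤ a)
    (hα3 : 1 / 3 ≤ α) (hα1 : α ≤ 1) (hτ : 1 ≤ τ) :
    (1 + a - γ) ^ 2 * (1 + α) / 8 * τ + 9 / 4 * γ * (a + (1 + a) * α)
      + γ * (1 + a) * (a + α * (1 + a)) ^ 2 / (2 * α * a)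
      + (a - γ) * (t - (3 * (1 + a) + τ))
      ≤ (a - γ) * (t + α * (3 * (1 + a) + τ - 1)) + (1 + α * (3 * (1 + a) + τ - 1)) / 2
        + 2 * (1 + a) * a * (1 + τ) := by
  have hapos : 0 < a := by linarith
  have hb : 2 * γ ≤ a - γ := by linarith
  -- The variable `t` cancels and the rest is affine in `τ`: `p1` compares the coefficients of `τ`,
  -- `p2` and `p3` the remaining terms.
  have p1 : (1 + a - γ) ^ 2 * (1 + α) / 8 * τ
      ≤ ((a - γ) + (a - γ) * α + α / 2 + 2 * (1 + a) * a) * τ := by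
    apply mul_le_mul_of_nonneg_right _ (by linarith)
    have : (1 + a - γ) ^ 2 = 1 + 2 * (a - γ) + (a - γ) ^ 2 := by ring
    rw [this]
    nlinarith [mul_nonneg (by linarith : 0 ≤ a - γ) (by linarith : 0 ≤ α),
      mul_nonneg (sq_nonneg (a - γ)) (by linarith : 0 ≤ 1 - α),
      mul_nonneg h0.le hapos.le, mul_nonneg h0.le (by linarith : 0 ≤ a - γ)]
  have g1 : γ * (1 + a) ≤ 4 / 3 * a := by nlinarith
  have p2 : γ * (1 + a) * (a + α * (1 + a)) ^ 2 / (2 * α * a)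
      ≤ 2 * a ^ 2 + 4 / 3 * a * (1 + a) + 2 / 3 * α * (1 + a) ^ 2 := by
    rw [div_le_iff₀ (by positivity)]
    have : γ * (1 + a) * (a + α * (1 + a)) ^ 2 ≤ 4 / 3 * a * (a + α * (1 + a)) ^ 2 :=
      mul_le_mul_of_nonneg_right g1 (sq_nonneg _)
    refine this.trans ?_
    nlinarith [mul_nonneg (mul_nonneg hapos.le (sq_nonneg a)) (by linarith : 0 ≤ α - 1 / 3)]
  have p3 : 9 / 4 * γ * (a + (1 + a) * α) + (2 * a ^ 2 + 4 / 3 * a * (1 + a)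
      + 2 / 3 * α * (1 + a) ^ 2) ≤ 3 * (a - γ) * (1 + a) + (a - γ) * α * (3 * (1 + a) - 1)
      + 1 / 2 + α * (3 * (1 + a) - 1) / 2 + 2 * (1 + a) * a := by
    have c1 : -(1 / 2) ≤ (a - γ) * (3 * a + 2) + (3 * a + 2) / 2 - 2 / 3 * (1 + a) ^ 2
        - 9 / 4 * (γ * (1 + a)) := by
      nlinarith [mul_nonneg (by linarith : 0 ≤ a - γ - 2 / 3 * a) hapos.le, sq_nonneg (a - 9 / 16)]
    have c2 : 1 / 2 ≤ 3 * (a - γ) * (1 + a) + 1 / 2 + 2 * (1 + a) * a - 2 * a ^ 2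
        - 4 / 3 * a * (1 + a) - 9 / 4 * (γ * a) := by
      nlinarith [mul_nonneg (by linarith : 0 ≤ a - γ - 2 / 3 * a) hapos.le,
        mul_nonneg (by linarith : 0 ≤ 1 - γ) hapos.le]
    nlinarith [mul_le_mul_of_nonneg_left c1 (by linarith : 0 ≤ α)]
  have hfin : (a - γ) * (t + α * (3 * (1 + a) + τ - 1)) + (1 + α * (3 * (1 + a) + τ - 1)) / 2
        + 2 * (1 + a) * a * (1 + τ) - (a - γ) * (t - (3 * (1 + a) + τ))
      = ((a - γ) + (a - γ) * α + α / 2 + 2 * (1 + a) * a) * τ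
        + (3 * (a - γ) * (1 + a) + (a - γ) * α * (3 * (1 + a) - 1)
      + 1 / 2 + α * (3 * (1 + a) - 1) / 2 + 2 * (1 + a) * a) := by ring
  linarith

/-- A window of `τ` consecutive squares is dominated by `(7/3) τ t (t - s)`. -/
theorem sum_window_sq_le {s t0 k : ℝ} {τ : ℕ} (hs : 1 ≤ s) (hτ : 1 ≤ τ) (hk : 0 ≤ k)
    (ht0 : t0 = 3 * s + τ) :
    ∑ j ∈ Finset.range τ, (k + t0 + 1 + j) ^ 2 + 4 / 3 * τ * k ^ 2
      ≤ 7 / 3 * τ * ((k + t0) * (k + t0 - s)) := by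
  have h : ∀ (c : ℝ) (m : ℕ), ∑ j ∈ Finset.range m, (c + 1 + j) ^ 2
      = m * (c ^ 2 + c * (m + 1) + (m + 1) * (2 * m + 1) / 6) := by
    intro c m
    induction m with
    | zero => simp
    | succ m ih => rw [Finset.sum_range_succ, ih]; push_cast; ring
  have hτ' : (1 : ℝ) ≤ τ := by exact_mod_cast hτ
  -- The constant `7/3 = 1 + 1 + 1/3` is forced by the leading order in `τ` at `k = 0`; the
  -- coefficient `4/3 = 7/3 - 1` is what is left at leading order in `k`.
  have : (k + t0) ^ 2 + (k + t0) * (τ + 1) + (τ + 1) * (2 * τ + 1) / 6 + 4 / 3 * k ^ 2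
      ≤ 7 / 3 * ((k + t0) * (k + t0 - s)) := by
    rw [ht0]
    nlinarith [mul_nonneg hk (by linarith : 0 ≤ s - 1), mul_nonneg hk (by linarith : 0 ≤ (τ:ℝ) - 1),
      mul_nonneg (by linarith : 0 ≤ s - 1) (by linarith : 0 ≤ (τ:ℝ) - 1),
      mul_nonneg (by linarith : 0 ≤ s - 1) (by linarith : 0 ≤ s - 1)]
  rw [h]
  nlinarith [mul_le_mul_of_nonneg_left this (by linarith : (0:ℝ) ≤ τ)]

/-! ### Sums and limits of real sequences. -/

/-- Exchange of the order of summation for delayed windows. -/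
theorem sum_delay_le {D ω : ℕ → ℝ} (hD0 : D 0 = 0) (hD : ∀ k, 0 ≤ D k) (hω : ∀ k, 0 ≤ ω k)
    (τ K : ℕ) :
    ∑ k ∈ Finset.range K, ω k * ∑ j ∈ Finset.range τ, D (k - j)
      ≤ ∑ k ∈ Finset.range K, D (k + 1) * ∑ j ∈ Finset.range τ, ω (k + 1 + j) := by
  simp_rw [Finset.mul_sum]
  rw [Finset.sum_comm, Finset.sum_comm (s := Finset.range K)]
  refine Finset.sum_le_sum fun j _ => ?_
  -- For fixed `j`, substitute `k ↦ j + k + 1`. The terms with `k ≤ j` vanish, because the truncated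
  -- difference is `0` and `D 0 = 0`.
  have h1 : ∑ k ∈ Finset.range K, ω k * D (k - j)
      ≤ ∑ k ∈ Finset.range (j + (K + 1)), ω k * D (k - j) :=
    Finset.sum_le_sum_of_subset_of_nonneg (Finset.range_mono (by omega))
      fun k _ _ => mul_nonneg (hω k) (hD _)
  refine h1.trans ?_
  rw [Finset.sum_range_add, Finset.sum_eq_zero (s := Finset.range j), zero_add,
    Finset.sum_range_succ', Nat.add_zero, Nat.sub_self, hD0, mul_zero, add_zero]
  · refine Finset.sum_le_sum fun k _ => ?_
    rw [Nat.add_sub_cancel_left, mul_comm, show j + (k + 1) = k + 1 + j by omega]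
  · intro k hk
    rw [Nat.sub_eq_zero_of_le (Finset.mem_range.1 hk).le, hD0, mul_zero]

/-- A nonnegative sequence that decreases up to summable errors converges. -/
theorem tendsto_of_le_add_summable {a ε : ℕ → ℝ} {B : ℝ} (ha : ∀ k, B ≤ a k) (hε : Summable ε)
    (h : ∀ k, a (k + 1) ≤ a k + ε k) : ∃ l, Tendsto a atTop (𝓝 l) := by
  set b : ℕ → ℝ := fun k => a k - ∑ i ∈ Finset.range k, ε i with hb
  have hanti : Antitone b := antitone_nat_of_succ_le fun k => by
    simp only [hb, Finset.sum_range_succ]; linarith [h k]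
  have hsum := hε.hasSum.tendsto_sum_nat
  obtain ⟨M, hM⟩ := hsum.bddAbove_range
  have hbdd : BddBelow (Set.range b) := by
    refine ⟨B - M, ?_⟩
    rintro _ ⟨k, rfl⟩
    have := hM ⟨k, rfl⟩
    simp only [hb] at *
    linarith [ha k]
  refine ⟨_, ((tendsto_atTop_ciInf hanti hbdd).add hsum).congr fun k => ?_⟩
  simp [hb]

/-- A convergent sequence whose quotients by `k + c` are summable tends to zero. -/
theorem tendsto_zero_of_summable_div {a : ℕ → ℝ} {l c : ℝ} (ha : ∀ k, 0 ≤ a k) (hc : 0 < c)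
    (hl : Tendsto a atTop (𝓝 l)) (hs : Summable fun k : ℕ => a k / (k + c)) :
    Tendsto a atTop (𝓝 0) := by
  have hl0 : 0 ≤ l := ge_of_tendsto' hl ha
  rcases hl0.eq_or_lt with h | h
  · rwa [h]
  exfalso
  obtain ⟨N, hN⟩ := eventually_atTop.1 (hl.eventually (lt_mem_nhds (half_lt_self h)))
  have h2 : Summable fun k : ℕ => (l / 2) * (1 / ((k : ℝ) + c)) := by
    rw [← summable_nat_add_iff N] at hs ⊢
    refine Summable.of_nonneg_of_le (fun k => by positivity) (fun k => ?_) hs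
    rw [mul_one_div]
    exact div_le_div_of_nonneg_right (hN _ (by omega)).le (by positivity)
  have h3 : Summable fun k : ℕ => 1 / ((k : ℝ) + c) :=
    (summable_mul_left_iff (by positivity)).1 h2
  have h4 : Summable fun k : ℕ => (1 : ℝ) / k := by
    rw [← summable_nat_add_iff 1]
    refine Summable.of_nonneg_of_le (fun k => by positivity) (fun k => ?_)
      (h3.mul_left (1 + c))
    rw [mul_one_div, div_le_div_iff₀ (by positivity) (by positivity)]
    push_cast
    nlinarith [Nat.cast_nonneg (α := ℝ) k]
  exact Real.not_summable_one_div_natCast h4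

/-! ### Inner product estimates and the energy identity. -/

/-- Completing the square. The discriminant form of the condition lets each cross term of the energy
be absorbed after one scalar check. -/
theorem inner_le_young {E : Type*} [NormedAddCommGroup E] [InnerProductSpace ℝ E] (u v : E)
    {A B c : ℝ} (hA : 0 < A) (h : c ^ 2 ≤ 4 * A * B) :
    c * inner ℝ u v ≤ A * ‖u‖ ^ 2 + B * ‖v‖ ^ 2 := by
  have h1 : c * inner ℝ u v ≤ |c| * (‖u‖ * ‖v‖) := by
    refine (le_abs_self _).trans ?_
    rw [abs_mul]
    exact mul_le_mul_of_nonneg_left (abs_real_inner_le_norm u v) (abs_nonneg c)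
  refine h1.trans ?_
  have h2 : 0 ≤ 4 * A * (A * ‖u‖ ^ 2 + B * ‖v‖ ^ 2 - |c| * (‖u‖ * ‖v‖)) := by
    have : 4 * A * (A * ‖u‖ ^ 2 + B * ‖v‖ ^ 2 - |c| * (‖u‖ * ‖v‖))
        = (2 * A * ‖u‖ - |c| * ‖v‖) ^ 2 + (4 * A * B - |c| ^ 2) * ‖v‖ ^ 2 := by ring
    rw [this, sq_abs]
    have := sub_nonneg.2 h
    positivity
  have := nonneg_of_mul_nonneg_right h2 (by positivity)
  linarith

theorem norm_add_sq_le_two_mul {E : Type*} [NormedAddCommGroup E] [InnerProductSpace ℝ E]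
    (u v : E) : ‖u + v‖ ^ 2 ≤ 2 * ‖u‖ ^ 2 + 2 * ‖v‖ ^ 2 := by
  have := parallelogram_law_with_norm ℝ u v
  nlinarith [sq_nonneg ‖u - v‖]

/-- The exact energy balance of one step. Here `w` is the scaled residual, `g` its increment,
`ζ = z - y`, `e` the scaled estimation error and `r = z - x⋆`. -/
theorem energy_balance {E : Type*} [NormedAddCommGroup E] [InnerProductSpace ℝ E]
    {s γ μ t : ℝ} (h0 : 0 < γ) (hs0 : 0 < s) (ht0 : 0 < t) (hts : 0 < t - s)
    (ht1 : 0 < t - 1) (w g ζ e r : E) :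
    1 / 2 * (t + μ) * t * ‖w + g‖ ^ 2
      - 2 * s * (t + μ) * inner ℝ (w + g) ((1 - s / t) • ζ + ((s - γ) / (2 * s)) • (w + e))
      + 2 * s ^ 2 / γ * (s - 1 + s * μ / t) * ‖r - (γ * t / (2 * s * (t - s))) • (w + e)‖ ^ 2
      - (1 / 2 * (t - 1 + μ) * (t - 1) * ‖w‖ ^ 2 - 2 * s * (t - 1 + μ) * inner ℝ w ζ
      + 2 * s ^ 2 / γ * (s - 1 + s * μ / (t - 1)) * ‖r‖ ^ 2)
      = -(2 * (t + μ) * (t - s))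
          * inner ℝ g ((s / t) • ζ - (1 / 2 * (1 + γ / (t - s))) • (w + e))
        + 1 / 2 * (t + μ) * t * ‖g‖ ^ 2 + (-((t + μ) * t)) * inner ℝ g e
        + (-((t + μ) * (s - γ))) * inner ℝ e w
        - ((s - 1 - γ) * (t + μ) + 1 / 2 + μ / 2) * ‖w‖ ^ 2
        - 2 * s * (s - 1 + s * μ / t) * inner ℝ w (r - ζ)
        + (-(2 * s ^ 2 * (s - 1 + s * μ / t) / (t - s))) * inner ℝ w r
        + (-(2 * s * (s - 1 + s * μ / t) * t / (t - s))) * inner ℝ e r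
        + γ * (s - 1 + s * μ / t) / 2 * (t / (t - s)) ^ 2 * ‖w + e‖ ^ 2
        - 2 * s ^ 3 / γ * μ / (t * (t - 1)) * ‖r‖ ^ 2 := by
  simp only [← real_inner_self_eq_norm_sq, inner_add_left, inner_add_right, inner_sub_left,
    inner_sub_right, inner_smul_left, inner_smul_right, conj_trivial]
  rw [real_inner_comm w g, real_inner_comm e w, real_inner_comm w r, real_inner_comm e r]
  field_simp
  ring

/-! ### Budgets for the coefficients of the energy. -/

/-- Relations between the parameters of the method and those of its energy. -/
structure EnergyParams (s γ α μ τ t k : ℝ) : Prop where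
  γ_pos : 0 < γ
  γ_le : γ ≤ 1
  s_ge : 1 + 3 * γ ≤ s
  α_eq : α * (s - 1) = s - 1 - 2 * γ
  τ_ge : 1 ≤ τ
  k_nonneg : 0 ≤ k
  t_eq : t = k + 3 * s + τ
  μ_eq : μ = α * (3 * s + τ - 1)

namespace EnergyParams

variable {s γ α μ τ t k : ℝ}

theorem s_pos (h : EnergyParams s γ α μ τ t k) : 0 < s := by linarith [h.γ_pos, h.s_ge]

theorem third_le_α (h : EnergyParams s γ α μ τ t k) : 1 / 3 ≤ α := by
  have := h.γ_pos; have := h.s_ge; have := h.α_eq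
  by_contra hc
  nlinarith

theorem α_pos (h : EnergyParams s γ α μ τ t k) : 0 < α := by linarith [h.third_le_α]

theorem α_le_one (h : EnergyParams s γ α μ τ t k) : α ≤ 1 := by
  have := h.γ_pos; have := h.s_ge; have := h.α_eq
  by_contra hc
  nlinarith

theorem μ_pos (h : EnergyParams s γ α μ τ t k) : 0 < μ := by
  have := h.γ_pos; have := h.s_ge; have := h.τ_ge
  rw [h.μ_eq]; apply mul_pos h.α_pos; linarith

theorem three_s_le (h : EnergyParams s γ α μ τ t k) : 3 * s + τ ≤ t := by
  rw [h.t_eq]; linarith [h.k_nonneg]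

theorem t_pos (h : EnergyParams s γ α μ τ t k) : 0 < t := by
  linarith [h.three_s_le, h.s_pos, h.τ_ge]

theorem sub_s_pos (h : EnergyParams s γ α μ τ t k) : 0 < t - s := by
  linarith [h.three_s_le, h.s_pos, h.τ_ge]

theorem sub_one_pos (h : EnergyParams s γ α μ τ t k) : 0 < t - 1 := by
  linarith [h.three_s_le, h.s_pos, h.τ_ge]

theorem μ_le' (h : EnergyParams s γ α μ τ t k) : μ ≤ α * (t - 1) := by
  rw [h.μ_eq]; apply mul_le_mul_of_nonneg_left _ h.α_pos.le; linarith [h.three_s_le]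

theorem μ_le (h : EnergyParams s γ α μ τ t k) : μ ≤ α * t := by
  linarith [h.μ_le', h.α_pos]

theorem χ_le (h : EnergyParams s γ α μ τ t k) : s - 1 + s * μ / t ≤ s - 1 + s * α := by
  have : s * μ / t ≤ s * α := by
    rw [div_le_iff₀ h.t_pos]; nlinarith [mul_le_mul_of_nonneg_left h.μ_le h.s_pos.le]
  linarith

theorem χ_pos (h : EnergyParams s γ α μ τ t k) : 0 < s - 1 + s * μ / t := by
  have := h.μ_pos; have := h.s_pos; have := h.t_pos
  have : 0 < s - 1 := by linarith [h.γ_pos, h.s_ge]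
  positivity

/-- The error's share of the squared step of `z`. It rests on `χ t ≤ s (t + μ)`, with `χ = s - 1 + s
μ / t`, and on `(t - s)² ≥ (2s + τ)² ≥ 8 s τ`. -/
theorem drift_error_le (h : EnergyParams s γ α μ τ t k) :
    2 * (γ * (s - 1 + s * μ / t) / 2 * (t / (t - s)) ^ 2) ≤ γ / 8 * (t * (t + μ) / τ) := by
  have hs := h.s_pos; have ht := h.t_pos; have hts := h.sub_s_pos; have hμ := h.μ_pos
  have hτ : 0 < τ := by linarith [h.τ_ge]
  have hγ := h.γ_pos
  have h1 : (s - 1 + s * μ / t) * t ≤ s * (t + μ) := by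
    field_simp; nlinarith
  have h2 : 8 * s * τ ≤ (t - s) ^ 2 := by
    have : (2 * s + τ) ^ 2 ≤ (t - s) ^ 2 :=
      pow_le_pow_left₀ (by positivity) (by linarith [h.three_s_le]) 2
    nlinarith [sq_nonneg (2 * s - τ)]
  have e1 : 2 * (γ * (s - 1 + s * μ / t) / 2 * (t / (t - s)) ^ 2)
      = γ * t * ((s - 1 + s * μ / t) * t) / (t - s) ^ 2 := by field_simp
  have e2 : γ / 8 * (t * (t + μ) / τ) = γ * t * (t + μ) / (8 * τ) := by field_simp
  rw [e1, e2, div_le_div_iff₀ (by positivity) (by positivity)]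
  calc γ * t * ((s - 1 + s * μ / t) * t) * (8 * τ) ≤ γ * t * (s * (t + μ)) * (8 * τ) := by gcongr
    _ = γ * t * (t + μ) * (8 * s * τ) := by ring
    _ ≤ γ * t * (t + μ) * (t - s) ^ 2 := by gcongr

/-- Discriminant condition for `⟪e, r⟫`. Since `μ ≤ α t`, the factors `χ` and `χ t / (t + μ)` are
largest at `μ = α t`, where `error_budget` applies. -/
theorem error_coupling_le (h : EnergyParams s γ α μ τ t k) :
    (-(2 * s * (s - 1 + s * μ / t) * t / (t - s))) ^ 2
      ≤ 4 * ((2 * (s - 1 - γ) + 29 / 16 - γ / 8) * (t * (t + μ) / τ))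
        * (2 * s ^ 3 * α * τ / γ / (t - s) ^ 2) := by
  have hs := h.s_pos; have ht := h.t_pos; have hts := h.sub_s_pos; have hμ := h.μ_pos
  have hτ : 0 < τ := by linarith [h.τ_ge]
  have hγ := h.γ_pos; have hα := h.α_pos
  have hχ := h.χ_le; have hχ0 := h.χ_pos
  have hU : 0 < t + μ := by positivity
  set χ := s - 1 + s * μ / t with hχd
  have h1 : χ * t * (1 + α) ≤ (s - 1 + s * α) * (t + μ) := by
    rw [hχd]; field_simp; nlinarith [h.μ_le]
  have h2 : γ * (s - 1 + s * α) ^ 2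
      ≤ 2 * α * s * (1 + α) * (2 * (s - 1 - γ) + 29 / 16 - γ / 8) := by
    have := error_budget h.γ_pos h.γ_le (by linarith [h.s_ge] : 3 * γ ≤ s - 1) h.α_eq
    rwa [add_sub_cancel] at this
  set θ := 2 * (s - 1 - γ) + 29 / 16 - γ / 8
  have hsα : 0 ≤ s - 1 + s * α := hχ0.le.trans hχ
  have h3 : γ * χ ^ 2 * t ≤ 2 * α * s * θ * (t + μ) := by
    refine le_of_mul_le_mul_right (a := 1 + α) ?_ (by positivity)
    calc γ * χ ^ 2 * t * (1 + α) = γ * χ * (χ * t * (1 + α)) := by ring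
      _ ≤ γ * (s - 1 + s * α) * ((s - 1 + s * α) * (t + μ)) := by gcongr
      _ = γ * (s - 1 + s * α) ^ 2 * (t + μ) := by ring
      _ ≤ 2 * α * s * (1 + α) * θ * (t + μ) := by gcongr
      _ = _ := by ring
  have e1 : (-(2 * s * χ * t / (t - s))) ^ 2 = γ * χ ^ 2 * t * (4 * s ^ 2 * t / (γ * (t - s) ^ 2)) := by
    field_simp; norm_num
  have e2 : 4 * (θ * (t * (t + μ) / τ)) * (2 * s ^ 3 * α * τ / γ / (t - s) ^ 2)
      = 2 * α * s * θ * (t + μ) * (4 * s ^ 2 * t / (γ * (t - s) ^ 2)) := by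
    field_simp
  rw [e1, e2]
  gcongr

/-- Discriminant condition for `⟪w, r⟫`, an equality once `χ` is replaced by its upper bound `s - 1
+ s α`. -/
theorem residual_coupling_le (h : EnergyParams s γ α μ τ t k) :
    (-(2 * s ^ 2 * (s - 1 + s * μ / t) / (t - s))) ^ 2
      ≤ 4 * (γ * s * (s - 1 + α * s) ^ 2 / (2 * α * (s - 1)))
        * (2 * s ^ 3 * α * (s - 1) / γ / (t - s) ^ 2) := by
  have hs := h.s_pos; have ht := h.t_pos; have hts := h.sub_s_pos
  have hγ := h.γ_pos; have hα := h.α_pos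
  have hχ := h.χ_le; have hχ0 := h.χ_pos
  have ha : 0 < s - 1 := by linarith [h.γ_pos, h.s_ge]
  set χ := s - 1 + s * μ / t
  have e2 : 4 * (γ * s * (s - 1 + α * s) ^ 2 / (2 * α * (s - 1)))
        * (2 * s ^ 3 * α * (s - 1) / γ / (t - s) ^ 2)
      = (2 * s ^ 2 * (s - 1 + s * α) / (t - s)) ^ 2 := by
    field_simp
    ring
  rw [e2, neg_sq]
  gcongr

/-- The Young costs in `‖w‖²` are paid by the energy identity and the co-coercivity gain against
`x⋆`; the surplus `(s - 1 - γ) k` later gives summability. -/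
theorem residual_coeff_le (h : EnergyParams s γ α μ τ t k) :
    (s - γ) ^ 2 * τ * (t + μ) / (8 * t)
      + 2 * (γ * (s - 1 + s * μ / t) / 2 * (t / (t - s)) ^ 2)
      + γ * s * (s - 1 + α * s) ^ 2 / (2 * α * (s - 1)) + (s - 1 - γ) * k
      ≤ (s - 1 - γ) * (t + μ) + 1 / 2 + μ / 2 + 2 * s * (s - 1 + s * μ / t) * (1 + τ) := by
  have hs := h.s_pos; have ht := h.t_pos; have hts := h.sub_s_pos; have hμ := h.μ_pos
  have hτ : 0 < τ := by linarith [h.τ_ge]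
  have hγ := h.γ_pos; have hα := h.α_pos
  have hχ := h.χ_le; have hχ0 := h.χ_pos
  have hχ1 : s - 1 ≤ s - 1 + s * μ / t := by
    have : 0 ≤ s * μ / t := by positivity
    linarith
  set χ := s - 1 + s * μ / t
  have h1 : (s - γ) ^ 2 * τ * (t + μ) / (8 * t) ≤ (s - γ) ^ 2 * (1 + α) / 8 * τ := by
    rw [div_le_iff₀ (by positivity)]
    have := mul_le_mul_of_nonneg_left h.μ_le (by positivity : 0 ≤ (s - γ) ^ 2 * τ)
    linarith
  have h2 : t / (t - s) ≤ 3 / 2 := by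
    rw [div_le_iff₀ hts]; linarith [h.three_s_le]
  have hsα : 0 ≤ s - 1 + s * α := hχ0.le.trans hχ
  have h3 : 2 * (γ * χ / 2 * (t / (t - s)) ^ 2) ≤ 9 / 4 * γ * (s - 1 + s * α) := by
    calc 2 * (γ * χ / 2 * (t / (t - s)) ^ 2) = γ * χ * (t / (t - s)) ^ 2 := by ring
      _ ≤ γ * (s - 1 + s * α) * (3 / 2) ^ 2 := by gcongr
      _ = _ := by ring
  have h4 := residual_budget t h.γ_pos h.γ_le (by linarith [h.s_ge] : 3 * γ ≤ s - 1)
    h.third_le_α h.α_le_one h.τ_ge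
  rw [add_sub_cancel, ← h.μ_eq] at h4
  have h5 : t - (3 * s + τ) = k := by rw [h.t_eq]; ring
  rw [h5] at h4
  have h6 : 2 * s * (s - 1) * (1 + τ) ≤ 2 * s * χ * (1 + τ) := by gcongr
  linarith

/-- This is what the shift `μ` is for: the right side is the decay of the anchor weight in one step,
and it pays for both Young terms in `‖r‖²`. -/
theorem anchor_coeff_le (h : EnergyParams s γ α μ τ t k) :
    2 * s ^ 3 * α * τ / γ / (t - s) ^ 2 + 2 * s ^ 3 * α * (s - 1) / γ / (t - s) ^ 2
      ≤ 2 * s ^ 3 / γ * μ / (t * (t - 1)) := by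
  have hs := h.s_pos; have ht := h.t_pos; have hts := h.sub_s_pos; have ht1 := h.sub_one_pos
  have hγ := h.γ_pos; have hα := h.α_pos
  have e1 : 2 * s ^ 3 * α * τ / γ / (t - s) ^ 2 + 2 * s ^ 3 * α * (s - 1) / γ / (t - s) ^ 2
      = 2 * s ^ 3 * α / γ * ((s + τ - 1) / (t - s) ^ 2) := by field_simp; ring
  have e2 : 2 * s ^ 3 / γ * μ / (t * (t - 1))
      = 2 * s ^ 3 * α / γ * ((3 * s + τ - 1) / (t * (t - 1))) := by
    rw [h.μ_eq]; field_simp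
  rw [e1, e2]
  apply mul_le_mul_of_nonneg_left _ (by positivity)
  rw [div_le_div_iff₀ (by positivity) (by positivity)]
  have h1 := h.three_s_le
  have h2 := h.τ_ge
  have h3 : 1 ≤ s := by linarith [h.γ_pos, h.s_ge]
  nlinarith [mul_nonneg (mul_nonneg hs.le ht.le) (by linarith : 0 ≤ t - (3 * s + τ - 1)),
    mul_nonneg (by linarith : 0 ≤ s + τ - 1) ht.le,
    mul_nonneg (sq_nonneg s) (by linarith : 0 ≤ 3 * s + τ - 1)]

end EnergyParams

/-! ### One-step inequality. -/

/-- One-step decrease of the energy of the accelerated fixed-point method. -/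
theorem energy_step {E : Type*} [NormedAddCommGroup E] [InnerProductSpace ℝ E]
    {s γ α μ τ t k D : ℝ} (h : EnergyParams s γ α μ τ t k) {w g ζ e r : E}
    (hcoco : (1 + τ) * ‖g‖ ^ 2 + 7 / 3 * (1 + s - γ) * τ * D
      ≤ inner ℝ g ((s / t) • ζ - (1 / 2 * (1 + γ / (t - s))) • (w + e)))
    (hmono : (1 + τ) * ‖w‖ ^ 2 ≤ inner ℝ w (r - ζ)) :
    1 / 2 * (t + μ) * t * ‖w + g‖ ^ 2
      - 2 * s * (t + μ) * inner ℝ (w + g) ((1 - s / t) • ζ + ((s - γ) / (2 * s)) • (w + e))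
      + 2 * s ^ 2 / γ * (s - 1 + s * μ / t) * ‖r - (γ * t / (2 * s * (t - s))) • (w + e)‖ ^ 2
      + (s - 1 - γ) * k * ‖w‖ ^ 2 + 5 / 6 * t * (t + μ) * ‖g‖ ^ 2
    ≤ 1 / 2 * (t - 1 + μ) * (t - 1) * ‖w‖ ^ 2 - 2 * s * (t - 1 + μ) * inner ℝ w ζ
      + 2 * s ^ 2 / γ * (s - 1 + s * μ / (t - 1)) * ‖r‖ ^ 2
      + 2 * (1 + s - γ) * (t * (t + μ) / τ) * ‖e‖ ^ 2
      - 14 / 3 * (1 + s - γ) * τ * (t + μ) * (t - s) * D := by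
  have hs0 := h.s_pos
  have ht0 := h.t_pos
  have hts := h.sub_s_pos
  have hμ0 := h.μ_pos
  have hγ := h.γ_pos
  have hα := h.α_pos
  have hτ : 0 < τ := by linarith [h.τ_ge]
  have ha : 0 < s - 1 := by linarith [h.γ_pos, h.s_ge]
  have hid := energy_balance (μ := μ) hγ hs0 ht0 hts h.sub_one_pos w g ζ e r
  have hU0 : 0 < t + μ := by positivity
  have hχ0 := h.χ_pos
  have hKe := h.drift_error_le
  have hn := h.error_coupling_le
  have hm := h.residual_coupling_le
  have hw := h.residual_coeff_le
  have hz := h.anchor_coeff_le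
  have hθ0 : 0 < 2 * (s - 1 - γ) + 29 / 16 - γ / 8 := by linarith [h.γ_le, h.s_ge]
  have hε0 : 0 < γ * s * (s - 1 + α * s) ^ 2 / (2 * α * (s - 1)) := by positivity
  have hK0 : 0 ≤ γ * (s - 1 + s * μ / t) / 2 * (t / (t - s)) ^ 2 := by positivity
  -- The error budget is split among the pairings of `e` with `g`, `w` and `r`, and the squared step
  -- of `z`, in this order.
  have hθ : 2 * (1 + s - γ) * (t * (t + μ) / τ)
      = (3 / 16 + 2 + (2 * (s - 1 - γ) + 29 / 16 - γ / 8) + γ / 8) * (t * (t + μ) / τ) := by ring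
  -- As `t ≥ 3s`, `2 (t - s) ≥ 4t/3`, which matches `1/2 + 4τ/3 + 5/6 = 4 (1 + τ)/3`.
  have hg : 1 / 2 * (t + μ) * t + 4 / 3 * τ * ((t + μ) * t) + 5 / 6 * t * (t + μ)
      ≤ 2 * (t + μ) * (t - s) * (1 + τ) := by
    have : 0 ≤ (t + μ) * ((1 + τ) * (t - 3 * s)) := by
      apply mul_nonneg hU0.le (mul_nonneg _ _) <;> linarith [h.three_s_le]
    linear_combination 2 / 3 * this
  have J1 := inner_le_young g e (A := 4 / 3 * τ * ((t + μ) * t))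
    (B := 3 / 16 * (t * (t + μ) / τ)) (c := -((t + μ) * t)) (by positivity)
    (le_of_eq (by field_simp; norm_num))
  have J2 := inner_le_young e w (A := 2 * (t * (t + μ) / τ))
    (B := (s - γ) ^ 2 * τ * (t + μ) / (8 * t)) (c := -((t + μ) * (s - γ))) (by positivity)
    (le_of_eq (by field_simp; ring))
  have J4 := inner_le_young e r (mul_pos hθ0 (by positivity)) hn
  have J5 := inner_le_young w r hε0 hm
  have hwe := norm_add_sq_le_two_mul w e
  have hc := mul_le_mul_of_nonneg_left hcoco (by positivity : 0 ≤ 2 * (t + μ) * (t - s))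
  have hmo := mul_le_mul_of_nonneg_left hmono
    (by positivity : 0 ≤ 2 * s * (s - 1 + s * μ / t))
  rw [hθ]
  clear hn hm hcoco hmono hθ h
  generalize ‖r - (γ * t / (2 * s * (t - s))) • (w + e)‖ ^ 2 = R' at *
  generalize inner ℝ (w + g) ((1 - s / t) • ζ + ((s - γ) / (2 * s)) • (w + e)) = I' at *
  generalize inner ℝ g ((s / t) • ζ - (1 / 2 * (1 + γ / (t - s))) • (w + e)) = I at *
  have J3 := mul_le_mul_of_nonneg_left hwe hK0
  have Ce := mul_le_mul_of_nonneg_right hKe (sq_nonneg ‖e‖)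
  have Cw := mul_le_mul_of_nonneg_right hw (sq_nonneg ‖w‖)
  have Cz := mul_le_mul_of_nonneg_right hz (sq_nonneg ‖r‖)
  have Cg := mul_le_mul_of_nonneg_right hg (sq_nonneg ‖g‖)
  linear_combination hid + hc + hmo + J1 + J2 + J3 + J4 + J5 + Ce + Cw + Cz + Cg

/-! ### Summed energy inequality and the rate along one trajectory. -/

/-- A trajectory of the accelerated fixed-point method with a delayed estimator, in scaled form:
`w k` stands for `η G (y k)`, `v k` for `η` times its estimator, and `D k` for the scaled mean
squared increment of the components between the iterations `k - 1` and `k`. -/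
structure DelayedTrajectory {E : Type*} [NormedAddCommGroup E] [InnerProductSpace ℝ E]
    (s γ : ℝ) (τ : ℕ) (w v y z : ℕ → E) (D : ℕ → ℝ) : Prop where
  γ_pos : 0 < γ
  γ_le : γ ≤ 1
  s_ge : 1 + 3 * γ ≤ s
  τ_ge : 1 ≤ τ
  zero : z 0 = y 0
  z_succ : ∀ k, z (k + 1) = z k - (γ * tPar s τ k / (2 * s * (tPar s τ k - s))) • v k
  sub_succ : ∀ k, z (k + 1) - y (k + 1)
    = (1 - s / tPar s τ k) • (z k - y k) + ((s - γ) / (2 * s)) • v k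
  y_sub : ∀ k, y (k + 1) - y k = (s / tPar s τ k) • (z k - y k)
    - (1 / 2 * (1 + γ / (tPar s τ k - s))) • v k
  coco : ∀ k, (1 + τ) * ‖w (k + 1) - w k‖ ^ 2 + 7 / 3 * (1 + s - γ) * τ * D (k + 1)
    ≤ inner ℝ (w (k + 1) - w k) (y (k + 1) - y k)
  D_zero : D 0 = 0
  D_nonneg : ∀ k, 0 ≤ D k
  delay : ∀ k, ‖v k - w k‖ ^ 2 ≤ τ * ∑ j ∈ Finset.range τ, D (k - j)

/-- The shift of the energy weights. -/
noncomputable def energyShift (s γ : ℝ) (τ : ℕ) : ℝ := (1 - 2 * γ / (s - 1)) * (3 * s + τ - 1)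

/-- The energy of the accelerated fixed-point method relative to the point `xs`. -/
noncomputable def energy {E : Type*} [NormedAddCommGroup E] [InnerProductSpace ℝ E] (s γ : ℝ) (τ : ℕ)
    (w y z : ℕ → E) (xs : E) (k : ℕ) : ℝ :=
  1 / 2 * (tPar s τ k - 1 + energyShift s γ τ) * (tPar s τ k - 1) * ‖w k‖ ^ 2
    - 2 * s * (tPar s τ k - 1 + energyShift s γ τ) * inner ℝ (w k) (z k - y k)
    + 2 * s ^ 2 / γ * (s - 1 + s * energyShift s γ τ / (tPar s τ k - 1)) * ‖z k - xs‖ ^ 2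

theorem tPar_succ (s : ℝ) (τ k : ℕ) : tPar s τ (k + 1) = tPar s τ k + 1 := by
  simp only [tPar]; push_cast; ring

theorem summable_add_pow_mul {f : ℕ → ℝ} (hf : ∀ k, 0 ≤ f k) {c : ℝ} (hc : 0 ≤ c) {q : ℕ}
    (h : Summable fun k : ℕ => (k : ℝ) ^ q * f k) :
    Summable fun k : ℕ => ((k : ℝ) + c) ^ q * f k := by
  rw [← summable_nat_add_iff 1] at h ⊢
  refine Summable.of_nonneg_of_le (fun k => mul_nonneg (by positivity) (hf _)) (fun k => ?_)
    (h.mul_left ((1 + c) ^ q))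
  rw [← mul_assoc, ← mul_pow]
  refine mul_le_mul_of_nonneg_right (pow_le_pow_left₀ (by positivity) ?_ _) (hf _)
  push_cast
  nlinarith [mul_nonneg hc (Nat.cast_nonneg (α := ℝ) k)]

namespace DelayedTrajectory

variable {E : Type*} [NormedAddCommGroup E] [InnerProductSpace ℝ E] {s γ : ℝ} {τ : ℕ}
  {w v y z : ℕ → E} {D : ℕ → ℝ} {xs : E}

theorem params (h : DelayedTrajectory s γ τ w v y z D) (k : ℕ) :
    EnergyParams s γ (1 - 2 * γ / (s - 1)) (energyShift s γ τ) τ (tPar s τ k) k where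
  γ_pos := h.γ_pos
  γ_le := h.γ_le
  s_ge := h.s_ge
  α_eq := by
    have : s - 1 ≠ 0 := by have := h.γ_pos; have := h.s_ge; intro h0; linarith
    field_simp
  τ_ge := by exact_mod_cast h.τ_ge
  k_nonneg := k.cast_nonneg
  t_eq := rfl
  μ_eq := rfl

theorem one_le_s (h : DelayedTrajectory s γ τ w v y z D) : 1 ≤ s := by
  linarith [h.γ_pos, h.s_ge]

theorem energy_succ_le (h : DelayedTrajectory s γ τ w v y z D)
    (hmono : ∀ k, (1 + τ) * ‖w k‖ ^ 2 ≤ inner ℝ (w k) (y k - xs)) (k : ℕ) :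
    energy s γ τ w y z xs (k + 1) + (s - 1 - γ) * k * ‖w k‖ ^ 2
      ≤ energy s γ τ w y z xs k
        + 2 * (1 + s - γ) * (tPar s τ k * (tPar s τ k + energyShift s γ τ) / τ)
          * ‖v k - w k‖ ^ 2
        - 14 / 3 * (1 + s - γ) * τ * (tPar s τ k + energyShift s γ τ) * (tPar s τ k - s)
          * D (k + 1) := by
  have hp := h.params k
  have hv : v k = w k + (v k - w k) := by abel
  have hw : w (k + 1) = w k + (w (k + 1) - w k) := by abel
  have hr : z k - y k = (z k - xs) - (y k - xs) := by abel
  have hr' : y k - xs = (z k - xs) - (z k - y k) := by abel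
  have hc := h.coco k
  rw [h.y_sub k, hv] at hc
  have hm := hmono k
  rw [hr'] at hm
  have hz : z (k + 1) - xs = (z k - xs)
      - (γ * tPar s τ k / (2 * s * (tPar s τ k - s))) • (w k + (v k - w k)) := by
    rw [h.z_succ k, ← hv]; abel
  have hζ := h.sub_succ k
  rw [hv] at hζ
  have hstep := energy_step hp hc hm
  rw [← hζ, ← hz, ← hw] at hstep
  simp only [energy, tPar_succ, add_sub_cancel_right]
  have := hp.t_pos
  have := hp.μ_pos
  have : 0 ≤ 5 / 6 * tPar s τ k * (tPar s τ k + energyShift s γ τ) * ‖w (k + 1) - w k‖ ^ 2 := by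
    positivity
  linarith

/-- Since `1 + μ / t` decreases in `t`, the factor `(t + μ) / t` can be taken out of the window,
which leaves `sum_window_sq_le`. -/
theorem window_weight_le (h : DelayedTrajectory s γ τ w v y z D) (k : ℕ) :
    ∑ j ∈ Finset.range τ, tPar s τ (k + 1 + j) * (tPar s τ (k + 1 + j) + energyShift s γ τ)
      + 4 / 3 * τ * (k : ℝ) ^ 2
      ≤ 7 / 3 * τ * ((tPar s τ k + energyShift s γ τ) * (tPar s τ k - s)) := by
  have hp := h.params k
  have ht := hp.t_pos
  have hμ := hp.μ_pos
  set t := tPar s τ k with htd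
  set μ := energyShift s γ τ
  have h1 := sum_window_sq_le (k := k) h.one_le_s h.τ_ge k.cast_nonneg rfl
  have h2 : (k : ℝ) + (3 * s + τ) = t := by rw [htd, tPar]; ring
  rw [h2] at h1
  have h3 : ∀ j : ℕ, tPar s τ (k + 1 + j) = t + 1 + j := fun j => by
    simp only [htd, tPar]; push_cast; ring
  have h4 : ∑ j ∈ Finset.range τ, tPar s τ (k + 1 + j) * (tPar s τ (k + 1 + j) + μ)
      ≤ (t + μ) / t * ∑ j ∈ Finset.range τ, (t + 1 + j) ^ 2 := by
    rw [Finset.mul_sum]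
    refine Finset.sum_le_sum fun j _ => ?_
    rw [h3, div_mul_eq_mul_div, le_div_iff₀ ht]
    have : 0 ≤ (t + 1 + j) * (μ * (1 + j)) := by positivity
    nlinarith
  have h5 := mul_le_mul_of_nonneg_left h1 (by positivity : 0 ≤ (t + μ) / t)
  have h6 : 4 / 3 * τ * (k : ℝ) ^ 2 ≤ (t + μ) / t * (4 / 3 * τ * (k : ℝ) ^ 2) := by
    apply le_mul_of_one_le_left (by positivity)
    rw [le_div_iff₀ ht]; linarith
  have h7 : (t + μ) / t * (7 / 3 * τ * (t * (t - s))) = 7 / 3 * τ * ((t + μ) * (t - s)) := by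
    field_simp
  linarith

/-- The errors at step `k` involve earlier increments, so they are compensated only in the sum:
`sum_delay_le` moves the weights onto `D (k + 1)`, and `window_weight_le` shows that its gain
dominates, with `k² D (k + 1)` to spare. -/
theorem energy_add_sum_le (h : DelayedTrajectory s γ τ w v y z D)
    (hmono : ∀ k, (1 + τ) * ‖w k‖ ^ 2 ≤ inner ℝ (w k) (y k - xs)) (K : ℕ) :
    energy s γ τ w y z xs K + ∑ k ∈ Finset.range K, ((s - 1 - γ) * (k * ‖w k‖ ^ 2)
        + 8 / 3 * (1 + s - γ) * τ * ((k : ℝ) ^ 2 * D (k + 1)))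
      ≤ energy s γ τ w y z xs 0 := by
  have hτ : (0 : ℝ) < τ := by exact_mod_cast h.τ_ge
  have hΛ : 0 < 1 + s - γ := by linarith [h.γ_pos, h.s_ge]
  set ω : ℕ → ℝ := fun k => tPar s τ k * (tPar s τ k + energyShift s γ τ) with hω
  have hω0 : ∀ k, 0 ≤ ω k := fun k => by
    have := (h.params k).t_pos; have := (h.params k).μ_pos
    simp only [hω]; positivity
  have hstep : ∀ k, energy s γ τ w y z xs (k + 1) + (s - 1 - γ) * (k * ‖w k‖ ^ 2)
      ≤ energy s γ τ w y z xs k + 2 * (1 + s - γ) * (ω k * ∑ j ∈ Finset.range τ, D (k - j))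
        - (2 * (1 + s - γ) * (D (k + 1) * ∑ j ∈ Finset.range τ, ω (k + 1 + j))
          + 8 / 3 * (1 + s - γ) * τ * ((k : ℝ) ^ 2 * D (k + 1))) := by
    intro k
    have h1 := h.energy_succ_le hmono k
    have h2 : 2 * (1 + s - γ) * (ω k / τ) * ‖v k - w k‖ ^ 2
        ≤ 2 * (1 + s - γ) * (ω k * ∑ j ∈ Finset.range τ, D (k - j)) := by
      have := mul_le_mul_of_nonneg_left (h.delay k)
        (mul_nonneg (by positivity) (div_nonneg (hω0 k) hτ.le) :
          0 ≤ 2 * (1 + s - γ) * (ω k / τ))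
      refine this.trans (le_of_eq ?_)
      field_simp
    have h3 := mul_le_mul_of_nonneg_left (h.window_weight_le k)
      (mul_nonneg (by positivity) (h.D_nonneg (k + 1)) : 0 ≤ 2 * (1 + s - γ) * D (k + 1))
    simp only [hω] at h2 ⊢
    linarith
  have hsum : energy s γ τ w y z xs K + ∑ k ∈ Finset.range K, ((s - 1 - γ) * (k * ‖w k‖ ^ 2)
        + 8 / 3 * (1 + s - γ) * τ * ((k : ℝ) ^ 2 * D (k + 1)))
      ≤ energy s γ τ w y z xs 0
        + 2 * (1 + s - γ) * ∑ k ∈ Finset.range K, ω k * ∑ j ∈ Finset.range τ, D (k - j)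
        - 2 * (1 + s - γ) * ∑ k ∈ Finset.range K,
            D (k + 1) * ∑ j ∈ Finset.range τ, ω (k + 1 + j) := by
    induction K with
    | zero => simp
    | succ K ih =>
      simp only [Finset.sum_range_succ, mul_add]
      linarith [hstep K]
  have := mul_le_mul_of_nonneg_left (sum_delay_le h.D_zero h.D_nonneg hω0 τ K)
    (by positivity : 0 ≤ 2 * (1 + s - γ))
  linarith

theorem inner_anchor_le (hmono : ∀ k, (1 + τ) * ‖w k‖ ^ 2 ≤ inner ℝ (w k) (y k - xs)) (k : ℕ) :
    inner ℝ (w k) (z k - y k) ≤ ‖w k‖ * ‖z k - xs‖ := by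
  have h1 : z k - y k = (z k - xs) - (y k - xs) := by abel
  have h2 := hmono k
  have h3 := real_inner_le_norm (w k) (z k - xs)
  have : 0 ≤ (1 + (τ : ℝ)) * ‖w k‖ ^ 2 := by positivity
  rw [h1, inner_sub_right]
  linarith

/-- The cross term is absorbed by the whole anchor term and part of the residual term. The choice of
`α`, equivalently `γ = (1 - α)(s - 1)/2`, leaves exactly the factor `(1 + α)/4`; the factor `1 + α`
also occurs in `energy_zero_le` and cancels in the rate. -/
theorem le_energy (h : DelayedTrajectory s γ τ w v y z D)
    (hmono : ∀ k, (1 + τ) * ‖w k‖ ^ 2 ≤ inner ℝ (w k) (y k - xs)) (k : ℕ) :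
    (1 + (1 - 2 * γ / (s - 1))) / 4 * ((tPar s τ k - 1) ^ 2 * ‖w k‖ ^ 2)
      ≤ energy s γ τ w y z xs k := by
  have hp := h.params k
  have hT := hp.sub_one_pos
  have hμ := hp.μ_pos
  have hs := hp.s_pos
  have hγ := h.γ_pos
  have ha : 0 < s - 1 := by linarith [h.s_ge]
  have hi := inner_anchor_le (z := z) hmono k
  have hαeq := hp.α_eq
  have hα0 := hp.α_pos
  simp only [energy]
  set α := 1 - 2 * γ / (s - 1)
  set T := tPar s τ k - 1
  set μ := energyShift s γ τ
  set c := 2 * s ^ 2 / γ * (s - 1 + s * μ / T) with hc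
  have hc0 : 0 < c := by positivity
  have hcge : 2 * s ^ 2 * (s - 1) * (T + μ) ≤ c * (γ * T) := by
    have : c * (γ * T) = 2 * s ^ 2 * ((s - 1) * T + s * μ) := by rw [hc]; field_simp
    rw [this]
    nlinarith [mul_nonneg (sq_nonneg s) hμ.le]
  have h1 := mul_le_mul_of_nonneg_left hi (by positivity : 0 ≤ 2 * s * (T + μ))
  have h2 : 2 * s * (T + μ) * (‖w k‖ * ‖z k - xs‖)
      ≤ γ * T * (T + μ) / (2 * (s - 1)) * ‖w k‖ ^ 2 + c * ‖z k - xs‖ ^ 2 := by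
    have e : (2 * s * (T + μ)) ^ 2 ≤ 4 * (γ * T * (T + μ) / (2 * (s - 1))) * c := by
      have : 4 * (γ * T * (T + μ) / (2 * (s - 1))) * c
          = 2 * (T + μ) / (s - 1) * (c * (γ * T)) := by field_simp; norm_num
      rw [this]
      refine le_trans (le_of_eq ?_) (mul_le_mul_of_nonneg_left hcge (by positivity))
      field_simp
    have h3 : 0 < γ * T * (T + μ) / (2 * (s - 1)) := by positivity
    have h4 := inner_le_young (‖w k‖ : ℝ) (‖z k - xs‖ : ℝ) h3 e
    simpa [mul_comm (‖z k - xs‖)] using h4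
  have h5 : (1 + α) / 4 * (T ^ 2 * ‖w k‖ ^ 2)
      ≤ 1 / 2 * (T + μ) * T * ‖w k‖ ^ 2 - γ * T * (T + μ) / (2 * (s - 1)) * ‖w k‖ ^ 2 := by
    have e : 1 / 2 * (T + μ) * T * ‖w k‖ ^ 2 - γ * T * (T + μ) / (2 * (s - 1)) * ‖w k‖ ^ 2
        = (1 + α) / 4 * ((T + μ) * T * ‖w k‖ ^ 2) := by
      have : γ = (1 - α) * (s - 1) / 2 := by linarith
      rw [this]; field_simp; ring
    rw [e, pow_two T]
    gcongr
    linarith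
  linarith

theorem energy_zero_le (h : DelayedTrajectory s γ τ w v y z D) :
    energy s γ τ w y z xs 0 ≤ (1 + (1 - 2 * γ / (s - 1)))
      * (1 / 2 * ((3 * s + τ - 1) ^ 2 * ‖w 0‖ ^ 2) + 2 * s ^ 3 / γ * ‖y 0 - xs‖ ^ 2) := by
  have hp := h.params 0
  have hT := hp.sub_one_pos
  have hs := hp.s_pos
  have hγ := h.γ_pos
  have hα := hp.α_pos
  have hT0 : tPar s τ 0 - 1 = 3 * s + τ - 1 := by simp [tPar]
  simp only [energy, h.zero, sub_self, inner_zero_right, energyShift]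
  rw [hT0] at hT ⊢
  set α := 1 - 2 * γ / (s - 1)
  set T := 3 * s + (τ : ℝ) - 1
  have e : s * (α * T) / T = s * α := by field_simp
  rw [e]
  have h1 : 2 * s ^ 2 / γ * (s - 1 + s * α) * ‖y 0 - xs‖ ^ 2
      ≤ (1 + α) * (2 * s ^ 3 / γ * ‖y 0 - xs‖ ^ 2) := by
    have : (1 + α) * (2 * s ^ 3 / γ * ‖y 0 - xs‖ ^ 2)
        = 2 * s ^ 2 / γ * (s + s * α) * ‖y 0 - xs‖ ^ 2 := by ring
    rw [this]
    gcongr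
    linarith
  nlinarith

/-- The `O(1/k²)` bound of the squared residual. -/
theorem residual_le (h : DelayedTrajectory s γ τ w v y z D)
    (hmono : ∀ k, (1 + τ) * ‖w k‖ ^ 2 ≤ inner ℝ (w k) (y k - xs)) (k : ℕ) :
    (tPar s τ k - 1) ^ 2 * ‖w k‖ ^ 2
      ≤ 4 * (1 / 2 * ((3 * s + τ - 1) ^ 2 * ‖w 0‖ ^ 2) + 2 * s ^ 3 / γ * ‖y 0 - xs‖ ^ 2) := by
  have h1 := h.energy_add_sum_le hmono k
  have hΛ : 0 < 1 + s - γ := by linarith [h.γ_pos, h.s_ge]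
  have hb : 0 < s - 1 - γ := by linarith [h.γ_pos, h.s_ge]
  have h2 : 0 ≤ ∑ k ∈ Finset.range k, ((s - 1 - γ) * (k * ‖w k‖ ^ 2)
        + 8 / 3 * (1 + s - γ) * τ * ((k : ℝ) ^ 2 * D (k + 1))) :=
    Finset.sum_nonneg fun i _ => by have := h.D_nonneg (i + 1); positivity
  have h3 := h.le_energy hmono k
  have h4 := h.energy_zero_le (xs := xs)
  have hα := (h.params 0).α_pos
  refine le_of_mul_le_mul_left (a := (1 + (1 - 2 * γ / (s - 1))) / 4) ?_ (by positivity)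
  linarith

end DelayedTrajectory

/-! ### Asymptotics along one trajectory. -/

namespace DelayedTrajectory

variable {E : Type*} [NormedAddCommGroup E] [InnerProductSpace ℝ E] {s γ : ℝ} {τ : ℕ}
  {w v y z : ℕ → E} {D : ℕ → ℝ} {xs : E}

theorem summable_weighted (h : DelayedTrajectory s γ τ w v y z D)
    (hmono : ∀ k, (1 + τ) * ‖w k‖ ^ 2 ≤ inner ℝ (w k) (y k - xs)) :
    (Summable fun k : ℕ => (k : ℝ) * ‖w k‖ ^ 2) ∧
      Summable fun k : ℕ => (k : ℝ) ^ 2 * D (k + 1) := by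
  have hΛ : 0 < 1 + s - γ := by linarith [h.γ_pos, h.s_ge]
  have hb : 0 < s - 1 - γ := by linarith [h.γ_pos, h.s_ge]
  have hτ : (0 : ℝ) < τ := by exact_mod_cast h.τ_ge
  have hnn : ∀ k : ℕ, 0 ≤ (k : ℝ) ^ 2 * D (k + 1) := fun k =>
    mul_nonneg (by positivity) (h.D_nonneg _)
  have hs : Summable fun k : ℕ => (s - 1 - γ) * (k * ‖w k‖ ^ 2)
        + 8 / 3 * (1 + s - γ) * τ * ((k : ℝ) ^ 2 * D (k + 1)) := by
    refine summable_of_sum_range_le (c := energy s γ τ w y z xs 0) (fun k => ?_) (fun K => ?_)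
    · have := hnn k
      positivity
    · have h1 := h.energy_add_sum_le hmono K
      have h2 := h.le_energy hmono K
      have := (h.params K).α_pos
      have : 0 ≤ (1 + (1 - 2 * γ / (s - 1))) / 4 * ((tPar s τ K - 1) ^ 2 * ‖w K‖ ^ 2) := by
        positivity
      linarith
  constructor
  · refine (summable_mul_left_iff hb.ne').1
      (Summable.of_nonneg_of_le (fun k => by positivity) (fun k => ?_) hs)
    have := hnn k
    have : 0 ≤ 8 / 3 * (1 + s - γ) * τ * ((k : ℝ) ^ 2 * D (k + 1)) := by positivity
    linarith
  · refine (summable_mul_left_iff (a := 8 / 3 * (1 + s - γ) * τ) (by positivity)).1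
      (Summable.of_nonneg_of_le (fun k => mul_nonneg (by positivity) (hnn k)) (fun k => ?_) hs)
    have : 0 ≤ (s - 1 - γ) * (k * ‖w k‖ ^ 2) := by positivity
    linarith

theorem summable_residual (h : DelayedTrajectory s γ τ w v y z D)
    (hmono : ∀ k, (1 + τ) * ‖w k‖ ^ 2 ≤ inner ℝ (w k) (y k - xs)) {c : ℝ} (hc : 0 ≤ c) :
    Summable fun k : ℕ => ((k : ℝ) + c) * ‖w k‖ ^ 2 := by
  simpa using summable_add_pow_mul (q := 1) (fun k => sq_nonneg ‖w k‖) hc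
    (by simpa using (h.summable_weighted hmono).1)

theorem summable_error (h : DelayedTrajectory s γ τ w v y z D)
    (hmono : ∀ k, (1 + τ) * ‖w k‖ ^ 2 ≤ inner ℝ (w k) (y k - xs)) {c : ℝ} (hc : 0 ≤ c) :
    Summable fun k : ℕ => ((k : ℝ) + c) ^ 2 * ‖v k - w k‖ ^ 2 := by
  have h1 : ∀ j : ℕ, Summable fun k : ℕ => ((k : ℝ) + c) ^ 2 * D (k - j) := by
    intro j
    -- The shift by `j + 1` removes the truncated subtraction and aligns the index with `D (k + 1)`.
    rw [← summable_nat_add_iff (j + 1)]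
    have := summable_add_pow_mul (fun k => h.D_nonneg (k + 1))
      (by positivity : 0 ≤ c + j + 1) (h.summable_weighted hmono).2
    refine this.congr fun k => ?_
    rw [show k + (j + 1) - j = k + 1 by omega]
    push_cast
    ring
  have h2 : Summable fun k : ℕ => ∑ j ∈ Finset.range τ, ((k : ℝ) + c) ^ 2 * D (k - j) :=
    summable_sum fun j _ => h1 j
  refine Summable.of_nonneg_of_le (fun k => by positivity) (fun k => ?_) (h2.mul_left (τ : ℝ))
  have := mul_le_mul_of_nonneg_left (h.delay k) (by positivity : 0 ≤ ((k : ℝ) + c) ^ 2)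
  rw [← Finset.mul_sum]
  linarith

theorem summable_estimator (h : DelayedTrajectory s γ τ w v y z D)
    (hmono : ∀ k, (1 + τ) * ‖w k‖ ^ 2 ≤ inner ℝ (w k) (y k - xs)) {c : ℝ} (hc : 1 ≤ c) :
    Summable fun k : ℕ => ((k : ℝ) + c) * ‖v k‖ ^ 2 := by
  have hc0 : 0 ≤ c := by linarith
  refine Summable.of_nonneg_of_le (fun k => by positivity) (fun k => ?_)
    (((h.summable_residual hmono hc0).mul_left 2).add ((h.summable_error hmono hc0).mul_left 2))
  have h1 := norm_add_sq_le_two_mul (w k) (v k - w k)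
  rw [add_sub_cancel] at h1
  have h2 := mul_le_mul_of_nonneg_left h1 (by positivity : 0 ≤ (k : ℝ) + c)
  have h3 : (1 : ℝ) ≤ k + c := by linarith [Nat.cast_nonneg (α := ℝ) k]
  have h4 : ((k : ℝ) + c) * ‖v k - w k‖ ^ 2 ≤ ((k : ℝ) + c) ^ 2 * ‖v k - w k‖ ^ 2 := by
    apply mul_le_mul_of_nonneg_right _ (sq_nonneg _)
    nlinarith
  linarith

theorem tendsto_estimator (h : DelayedTrajectory s γ τ w v y z D)
    (hmono : ∀ k, (1 + τ) * ‖w k‖ ^ 2 ≤ inner ℝ (w k) (y k - xs)) :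
    Tendsto v atTop (𝓝 0) := by
  have h1 := (h.summable_estimator hmono le_rfl).tendsto_atTop_zero
  have h2 : Tendsto (fun k => ‖v k‖ ^ 2) atTop (𝓝 0) := by
    refine squeeze_zero (fun k => sq_nonneg _) (fun k => ?_) h1
    exact le_mul_of_one_le_left (sq_nonneg _) (by linarith [Nat.cast_nonneg (α := ℝ) k])
  rw [tendsto_zero_iff_norm_tendsto_zero]
  simpa using h2.sqrt

theorem tPar_eq (k : ℕ) : tPar s τ k = k + (3 * s + τ) := by rw [tPar]; ring

/-- The new difference is a convex combination, with weight `s / t`, of the old one and a multiple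
of `v k`; the square is convex. -/
theorem sub_succ_norm_sq_le (h : DelayedTrajectory s γ τ w v y z D) (k : ℕ) :
    ‖z (k + 1) - y (k + 1)‖ ^ 2 + s / tPar s τ k * ‖z k - y k‖ ^ 2
      ≤ ‖z k - y k‖ ^ 2 + (s - γ) ^ 2 / (4 * s ^ 3) * (tPar s τ k * ‖v k‖ ^ 2) := by
  have hp := h.params k
  have hs := hp.s_pos
  have ht := hp.t_pos
  have hts := hp.sub_s_pos
  set t := tPar s τ k
  have hρ0 : 0 < s / t := by positivity
  have hρ1 : 0 ≤ 1 - s / t := by rw [sub_nonneg, div_le_one ht]; linarith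
  have h1 : ((s - γ) / (2 * s)) • v k = (s / t) • (((s - γ) * t / (2 * s ^ 2)) • v k) := by
    rw [smul_smul]; congr 1; field_simp
  have h2 : ‖z (k + 1) - y (k + 1)‖ ≤ (1 - s / t) * ‖z k - y k‖
      + (s / t) * ‖((s - γ) * t / (2 * s ^ 2)) • v k‖ := by
    rw [h.sub_succ k, h1]
    refine (norm_add_le _ _).trans ?_
    rw [norm_smul (1 - s / t), norm_smul (s / t), Real.norm_of_nonneg hρ0.le,
      Real.norm_of_nonneg hρ1]
  have h3 : ‖((s - γ) * t / (2 * s ^ 2)) • v k‖ ^ 2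
      = ((s - γ) * t / (2 * s ^ 2)) ^ 2 * ‖v k‖ ^ 2 := by
    rw [norm_smul, mul_pow, Real.norm_eq_abs, sq_abs]
  set X := ‖((s - γ) * t / (2 * s ^ 2)) • v k‖
  have h4 : ‖z (k + 1) - y (k + 1)‖ ^ 2 ≤ ((1 - s / t) * ‖z k - y k‖ + (s / t) * X) ^ 2 :=
    pow_le_pow_left₀ (norm_nonneg _) h2 2
  have h5 : (s - γ) ^ 2 / (4 * s ^ 3) * (t * ‖v k‖ ^ 2) = (s / t) * X ^ 2 := by
    rw [h3]; field_simp; ring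
  rw [h5]
  nlinarith [mul_nonneg (mul_nonneg hρ1 hρ0.le) (sq_nonneg (‖z k - y k‖ - X))]

/-- Telescoping the previous estimate makes the squared norms convergent and their quotients by `t`
summable, so the divergence of the harmonic series forces the limit to be zero. -/
theorem tendsto_sub (h : DelayedTrajectory s γ τ w v y z D)
    (hmono : ∀ k, (1 + τ) * ‖w k‖ ^ 2 ≤ inner ℝ (w k) (y k - xs)) :
    (Summable fun k : ℕ => ‖z k - y k‖ ^ 2 / tPar s τ k) ∧
      Tendsto (fun k => z k - y k) atTop (𝓝 0) := by
  have hs := (h.params 0).s_pos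
  have hc : 1 ≤ 3 * s + (τ : ℝ) := by
    have := h.one_le_s
    have : (0 : ℝ) ≤ τ := τ.cast_nonneg
    linarith
  have h1 : Summable fun k : ℕ => (s - γ) ^ 2 / (4 * s ^ 3) * (tPar s τ k * ‖v k‖ ^ 2) := by
    simp only [tPar_eq]
    exact (h.summable_estimator hmono hc).mul_left _
  have hstep := h.sub_succ_norm_sq_le
  have hnn : ∀ k, 0 ≤ s / tPar s τ k * ‖z k - y k‖ ^ 2 := fun k => by
    have := (h.params k).t_pos; positivity
  obtain ⟨l, hl⟩ := tendsto_of_le_add_summable (a := fun k => ‖z k - y k‖ ^ 2) (B := 0)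
    (fun k => sq_nonneg _) h1 (fun k => by linarith [hstep k, hnn k])
  have h2 : Summable fun k : ℕ => ‖z k - y k‖ ^ 2 / tPar s τ k := by
    refine (summable_mul_left_iff (a := s) hs.ne').1 ?_
    obtain ⟨M, hM⟩ := h1.hasSum.tendsto_sum_nat.bddAbove_range
    refine summable_of_sum_range_le (c := ‖z 0 - y 0‖ ^ 2 + M) (fun k => ?_) (fun K => ?_)
    · have := (h.params k).t_pos
      positivity
    · have h3 : ∀ K, ‖z K - y K‖ ^ 2
          + ∑ k ∈ Finset.range K, s * (‖z k - y k‖ ^ 2 / tPar s τ k)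
          ≤ ‖z 0 - y 0‖ ^ 2 + ∑ k ∈ Finset.range K,
            (s - γ) ^ 2 / (4 * s ^ 3) * (tPar s τ k * ‖v k‖ ^ 2) := by
        intro K
        induction K with
        | zero => simp
        | succ K ih =>
          rw [Finset.sum_range_succ, Finset.sum_range_succ]
          have e : s * (‖z K - y K‖ ^ 2 / tPar s τ K) = s / tPar s τ K * ‖z K - y K‖ ^ 2 := by
            ring
          rw [e]
          linarith [hstep K]
      have h4 := hM ⟨K, rfl⟩
      have h5 := h3 K
      have := sq_nonneg ‖z K - y K‖
      dsimp only at h4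
      linarith
  refine ⟨h2, ?_⟩
  have h3 := tendsto_zero_of_summable_div (c := 3 * s + τ) (fun k => sq_nonneg _)
    (by linarith) hl
    (by simpa only [tPar_eq] using h2)
  rw [tendsto_zero_iff_norm_tendsto_zero]
  simpa using h3.sqrt

theorem norm_anchor_bounded (h : DelayedTrajectory s γ τ w v y z D)
    (hmono : ∀ k, (1 + τ) * ‖w k‖ ^ 2 ≤ inner ℝ (w k) (y k - xs)) :
    ∃ M, ∀ k, ‖z k - xs‖ ≤ M := by
  set B := 4 * (1 / 2 * ((3 * s + τ - 1) ^ 2 * ‖w 0‖ ^ 2) + 2 * s ^ 3 / γ * ‖y 0 - xs‖ ^ 2)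
    with hB
  have hs := (h.params 0).s_pos
  have hγ := h.γ_pos
  have hΛ : 0 < 1 + s - γ := by linarith [h.γ_pos, h.s_ge]
  have hb : 0 < s - 1 - γ := by linarith [h.γ_pos, h.s_ge]
  have ha : 0 < s - 1 := by linarith
  set c := 2 * s ^ 2 / γ * (s - 1) with hc
  have hc0 : 0 < c := by positivity
  set e0 := energy s γ τ w y z xs 0
  -- Only half of the anchor term is spent on the cross term here; the rest of that term is
  -- controlled by the rate already proved.
  refine ⟨Real.sqrt ((e0 + 8 * s ^ 2 / c * B) / (c / 2)), fun k => ?_⟩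
  have hp := h.params k
  have hT := hp.sub_one_pos
  have hμ := hp.μ_pos
  have hμT := hp.μ_le'
  have hα1 := hp.α_le_one
  apply Real.le_sqrt_of_sq_le
  rw [le_div_iff₀ (by positivity)]
  have h1 := h.energy_add_sum_le hmono k
  have h2 : 0 ≤ ∑ k ∈ Finset.range k, ((s - 1 - γ) * (k * ‖w k‖ ^ 2)
        + 8 / 3 * (1 + s - γ) * τ * ((k : ℝ) ^ 2 * D (k + 1))) :=
    Finset.sum_nonneg fun i _ => by have := h.D_nonneg (i + 1); positivity
  have h3 : energy s γ τ w y z xs k ≤ e0 := by linarith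
  have h4 := h.residual_le hmono k
  rw [← hB] at h4
  have hi := inner_anchor_le (z := z) hmono k
  simp only [energy] at h3
  set T := tPar s τ k - 1
  set μ := energyShift s γ τ
  have h5 := mul_le_mul_of_nonneg_left hi (by positivity : 0 ≤ 2 * s * (T + μ))
  have h6 : 2 * s * (T + μ) * (‖w k‖ * ‖z k - xs‖)
      ≤ 2 * s ^ 2 / c * ((T + μ) ^ 2 * ‖w k‖ ^ 2) + c / 2 * ‖z k - xs‖ ^ 2 := by
    have h7 := inner_le_young (‖w k‖ : ℝ) (‖z k - xs‖ : ℝ)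
      (A := 2 * s ^ 2 / c * (T + μ) ^ 2) (B := c / 2) (c := 2 * s * (T + μ)) (by positivity)
      (le_of_eq (by field_simp; norm_num))
    simpa [mul_comm (‖z k - xs‖), mul_assoc] using h7
  have h7 : (T + μ) ^ 2 * ‖w k‖ ^ 2 ≤ 4 * B := by
    have : (T + μ) ^ 2 ≤ (2 * T) ^ 2 :=
      pow_le_pow_left₀ (by positivity) (by nlinarith) 2
    nlinarith [mul_le_mul_of_nonneg_right this (sq_nonneg ‖w k‖)]
  have h8 := mul_le_mul_of_nonneg_left h7 (by positivity : 0 ≤ 2 * s ^ 2 / c)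
  have h9 : c * ‖z k - xs‖ ^ 2
      ≤ 2 * s ^ 2 / γ * (s - 1 + s * μ / T) * ‖z k - xs‖ ^ 2 := by
    rw [hc]
    gcongr
    have : 0 ≤ s * μ / T := by positivity
    linarith
  have h10 : 0 ≤ 1 / 2 * (T + μ) * T * ‖w k‖ ^ 2 := by positivity
  linear_combination h3 + h5 + h6 + h8 + h9 + h10

/-- Quasi-Fejér monotonicity. In `⟪v, z - x⋆⟫` the part `⟪w, y - x⋆⟫` has the good sign, `⟪w, z -
y⟫` is summable by Young with weights `t` and `1/t`, and the error part by boundedness of `z` and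
Young with weights `t²` and `1/t²`. -/
theorem exists_tendsto_anchor (h : DelayedTrajectory s γ τ w v y z D)
    (hmono : ∀ k, (1 + τ) * ‖w k‖ ^ 2 ≤ inner ℝ (w k) (y k - xs)) :
    ∃ l, Tendsto (fun k => ‖z k - xs‖ ^ 2) atTop (𝓝 l) := by
  obtain ⟨M, hM⟩ := h.norm_anchor_bounded hmono
  have hM0 : 0 ≤ M := (norm_nonneg _).trans (hM 0)
  have hs := (h.params 0).s_pos
  have hγ := h.γ_pos
  have hc : 1 ≤ 3 * s + (τ : ℝ) := by
    have := h.one_le_s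
    have : (0 : ℝ) ≤ τ := τ.cast_nonneg
    linarith
  have hc0 : 0 ≤ 3 * s + (τ : ℝ) := by linarith
  have hinv : Summable fun k : ℕ => 1 / (tPar s τ k) ^ 2 := by
    rw [← summable_nat_add_iff 1]
    have : Summable fun k : ℕ => 1 / ((k : ℝ)) ^ 2 := Real.summable_one_div_nat_pow.2 one_lt_two
    rw [← summable_nat_add_iff 1] at this
    refine Summable.of_nonneg_of_le (fun k => by positivity) (fun k => ?_) this
    apply one_div_le_one_div_of_le (by positivity)
    apply pow_le_pow_left₀ (by positivity)
    rw [tPar_eq]; linarith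
  have hW : Summable fun k : ℕ => tPar s τ k * ‖w k‖ ^ 2 := by
    simp only [tPar_eq]; exact h.summable_residual hmono hc0
  have hV : Summable fun k : ℕ => tPar s τ k * ‖v k‖ ^ 2 := by
    simp only [tPar_eq]; exact h.summable_estimator hmono hc
  have hE : Summable fun k : ℕ => (tPar s τ k) ^ 2 * ‖v k - w k‖ ^ 2 := by
    simp only [tPar_eq]; exact h.summable_error hmono hc0
  have hsum := ((((hW.add (h.tendsto_sub hmono).1).add ((hE.add hinv).mul_left M)).mul_left
    (3 * γ / (4 * s))).add (hV.mul_left ((3 * γ / (4 * s)) ^ 2)))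
  refine tendsto_of_le_add_summable (B := 0) (fun k => sq_nonneg _) hsum fun k => ?_
  have hp := h.params k
  have ht := hp.t_pos
  have hts := hp.sub_s_pos
  have h3 := hp.three_s_le
  have hzs : z (k + 1) - xs = (z k - xs)
      - (γ * tPar s τ k / (2 * s * (tPar s τ k - s))) • v k := by rw [h.z_succ k]; abel
  rw [hzs]
  set t := tPar s τ k
  set κ := γ * t / (2 * s * (t - s)) with hκ
  have hκ0 : 0 ≤ κ := by positivity
  have hκ1 : κ ≤ 3 * γ / (4 * s) := by
    rw [hκ, div_le_div_iff₀ (by positivity) (by positivity)]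
    have : 0 ≤ γ * s * (t - 3 * s) := by
      apply mul_nonneg (by positivity)
      linarith [Nat.cast_nonneg (α := ℝ) τ]
    nlinarith
  have e1 : -inner ℝ (z k - xs) (v k) ≤ (t * ‖w k‖ ^ 2 + ‖z k - y k‖ ^ 2 / t
      + M * (t ^ 2 * ‖v k - w k‖ ^ 2 + 1 / t ^ 2)) / 2 := by
    have i1 : inner ℝ (z k - xs) (v k) = inner ℝ (w k) (z k - y k)
        + inner ℝ (w k) (y k - xs) + inner ℝ (v k - w k) (z k - xs) := by
      rw [← inner_add_right, ← real_inner_comm]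
      nth_rewrite 1 [← sub_add_cancel (v k) (w k)]
      rw [inner_add_left, sub_add_sub_cancel, add_comm]
    have i2 : 0 ≤ inner ℝ (w k) (y k - xs) := le_trans (by positivity) (hmono k)
    have i3 := inner_le_young (w k) (z k - y k) (A := t / 2) (B := 1 / (2 * t)) (c := -1)
      (by positivity) (le_of_eq (by field_simp; norm_num))
    have i4 : -inner ℝ (v k - w k) (z k - xs) ≤ ‖v k - w k‖ * M := by
      have := abs_real_inner_le_norm (v k - w k) (z k - xs)
      have := neg_abs_le (inner ℝ (v k - w k) (z k - xs))
      have := mul_le_mul_of_nonneg_left (hM k) (norm_nonneg (v k - w k))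
      linarith
    have i5 : ‖v k - w k‖ ≤ (t ^ 2 * ‖v k - w k‖ ^ 2 + 1 / t ^ 2) / 2 := by
      have : 0 ≤ (t * ‖v k - w k‖ - 1 / t) ^ 2 := sq_nonneg _
      have e : (t * ‖v k - w k‖ - 1 / t) ^ 2
          = t ^ 2 * ‖v k - w k‖ ^ 2 + 1 / t ^ 2 - 2 * ‖v k - w k‖ := by field_simp; ring
      linarith
    have i6 := mul_le_mul_of_nonneg_right i5 hM0
    have i7 : 1 / (2 * t) * ‖z k - y k‖ ^ 2 = ‖z k - y k‖ ^ 2 / t / 2 := by field_simp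
    rw [i1]
    linarith
  have e2 : ‖z k - xs - κ • v k‖ ^ 2
      = ‖z k - xs‖ ^ 2 + κ * (2 * -inner ℝ (z k - xs) (v k)) + κ ^ 2 * ‖v k‖ ^ 2 := by
    rw [norm_sub_sq_real, inner_smul_right, norm_smul, Real.norm_of_nonneg hκ0]; ring
  set Q := t * ‖w k‖ ^ 2 + ‖z k - y k‖ ^ 2 / t
      + M * (t ^ 2 * ‖v k - w k‖ ^ 2 + 1 / t ^ 2)
  have hQ : 0 ≤ Q := by positivity
  have e3 : κ * (2 * -inner ℝ (z k - xs) (v k)) ≤ 3 * γ / (4 * s) * Q :=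
    (mul_le_mul_of_nonneg_left (by linarith) hκ0).trans (mul_le_mul_of_nonneg_right hκ1 hQ)
  have e4 : κ ^ 2 * ‖v k‖ ^ 2 ≤ (3 * γ / (4 * s)) ^ 2 * (t * ‖v k‖ ^ 2) := by
    apply mul_le_mul (pow_le_pow_left₀ hκ0 hκ1 2) _ (by positivity) (by positivity)
    apply le_mul_of_one_le_left (by positivity)
    linarith
  rw [e2]
  linarith

/-- The energy minus its convergent anchor and vanishing cross terms leaves a convergent residual
term; its quotients by `t - 1` are summable, so its limit is zero. -/
theorem tendsto_sq_mul_residual (h : DelayedTrajectory s γ τ w v y z D)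
    (hmono : ∀ k, (1 + τ) * ‖w k‖ ^ 2 ≤ inner ℝ (w k) (y k - xs)) :
    Tendsto (fun k => (tPar s τ k - 1) ^ 2 * ‖w k‖ ^ 2) atTop (𝓝 0) := by
  set B := 4 * (1 / 2 * ((3 * s + τ - 1) ^ 2 * ‖w 0‖ ^ 2) + 2 * s ^ 3 / γ * ‖y 0 - xs‖ ^ 2)
    with hB
  have hs := (h.params 0).s_pos
  have hγ := h.γ_pos
  have hΛ : 0 < 1 + s - γ := by linarith [h.γ_pos, h.s_ge]
  have hτ : (1 : ℝ) ≤ τ := by exact_mod_cast h.τ_ge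
  have hb : 0 < s - 1 - γ := by linarith [h.γ_pos, h.s_ge]
  have hc0 : 0 < 3 * s + (τ : ℝ) - 1 := by linarith
  have hT : ∀ k : ℕ, tPar s τ k - 1 = k + (3 * s + (τ : ℝ) - 1) := fun k => by
    rw [tPar_eq]; ring
  have hμT : ∀ k, energyShift s γ τ ≤ tPar s τ k - 1 := fun k => by
    have hp := h.params k
    have := hp.μ_le'; have := hp.α_le_one; have := hp.sub_one_pos
    nlinarith
  -- convergence of the energy
  have hE : Summable fun k : ℕ => (tPar s τ k) ^ 2 * ‖v k - w k‖ ^ 2 := by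
    simp only [tPar_eq]; exact h.summable_error hmono (by linarith)
  obtain ⟨l, hl⟩ := tendsto_of_le_add_summable (a := energy s γ τ w y z xs) (B := 0)
    (fun k => by
      have := (h.params k).α_pos
      exact le_trans (by positivity) (h.le_energy hmono k))
    (hE.mul_left (2 * (1 + s - γ) * 2)) (fun k => by
      have hp := h.params k
      have := h.energy_succ_le hmono k
      have hts := hp.sub_s_pos
      have ht := hp.t_pos
      have hμ := hp.μ_pos
      have hD := h.D_nonneg (k + 1)
      set t := tPar s τ k
      set μ := energyShift s γ τ
      have h1 : 0 ≤ (s - 1 - γ) * k * ‖w k‖ ^ 2 := by positivity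
      have h2 : 0 ≤ 14 / 3 * (1 + s - γ) * τ * (t + μ) * (t - s) * D (k + 1) := by positivity
      have h3 : t * (t + μ) / τ ≤ 2 * t ^ 2 := by
        rw [div_le_iff₀ (by linarith)]
        have : μ ≤ t := (hμT k).trans (by linarith)
        nlinarith [mul_nonneg (sq_nonneg t) (by linarith : 0 ≤ (τ : ℝ) - 1)]
      have h4 := mul_le_mul_of_nonneg_left h3
        (by positivity : 0 ≤ 2 * (1 + s - γ) * ‖v k - w k‖ ^ 2)
      linarith)
  obtain ⟨l', hl'⟩ := h.exists_tendsto_anchor hmono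
  -- the cross term vanishes
  have hcross : Tendsto (fun k => 2 * s * (tPar s τ k - 1 + energyShift s γ τ)
      * inner ℝ (w k) (z k - y k)) atTop (𝓝 0) := by
    have h1 : Tendsto (fun k => 4 * s * Real.sqrt B * ‖z k - y k‖) atTop (𝓝 0) := by
      simpa using ((h.tendsto_sub hmono).2.norm.const_mul (4 * s * Real.sqrt B))
    refine squeeze_zero_norm (fun k => ?_) h1
    have hT0 := (h.params k).sub_one_pos
    have hμ := (h.params k).μ_pos
    have h2 := h.residual_le hmono k
    rw [← hB, ← mul_pow] at h2
    have h3 := Real.le_sqrt_of_sq_le h2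
    have h4 := abs_real_inner_le_norm (w k) (z k - y k)
    have hμk := hμT k
    set T := tPar s τ k - 1
    rw [Real.norm_eq_abs, abs_mul, abs_of_nonneg (by positivity : 0 ≤ 2 * s * (T + _))]
    calc 2 * s * (T + energyShift s γ τ) * |inner ℝ (w k) (z k - y k)|
        ≤ 2 * s * (T + T) * (‖w k‖ * ‖z k - y k‖) := by gcongr
      _ = 4 * s * (T * ‖w k‖) * ‖z k - y k‖ := by ring
      _ ≤ 4 * s * Real.sqrt B * ‖z k - y k‖ := by gcongr
  have hTinv : Tendsto (fun k => s * energyShift s γ τ / (tPar s τ k - 1)) atTop (𝓝 0) := by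
    simp only [hT]
    exact tendsto_const_nhds.div_atTop
      (tendsto_atTop_add_const_right _ _ tendsto_natCast_atTop_atTop)
  have hA := (hl.add hcross).sub
    (((tendsto_const_nhds (x := s - 1)).add hTinv).const_mul (2 * s ^ 2 / γ) |>.mul hl')
  have hA' : Tendsto (fun k => 1 / 2 * (tPar s τ k - 1 + energyShift s γ τ) * (tPar s τ k - 1)
      * ‖w k‖ ^ 2) atTop (𝓝 (l + 0 - 2 * s ^ 2 / γ * (s - 1 + 0) * l')) := by
    refine hA.congr fun k => ?_
    simp only [energy]
    ring
  have hbd : ∀ k, 0 ≤ 1 / 2 * (tPar s τ k - 1 + energyShift s γ τ) * (tPar s τ k - 1)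
      * ‖w k‖ ^ 2 ∧ (tPar s τ k - 1) ^ 2 * ‖w k‖ ^ 2
      ≤ 2 * (1 / 2 * (tPar s τ k - 1 + energyShift s γ τ) * (tPar s τ k - 1) * ‖w k‖ ^ 2) ∧
      1 / 2 * (tPar s τ k - 1 + energyShift s γ τ) * (tPar s τ k - 1) * ‖w k‖ ^ 2
        ≤ (tPar s τ k - 1) ^ 2 * ‖w k‖ ^ 2 := by
    intro k
    have hT0 := (h.params k).sub_one_pos
    have hμ := (h.params k).μ_pos
    have hμk := hμT k
    set T := tPar s τ k - 1
    set μ := energyShift s γ τ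
    have hw := sq_nonneg ‖w k‖
    refine ⟨by positivity, ?_, mul_le_mul_of_nonneg_right (by nlinarith) hw⟩
    rw [← mul_assoc]
    exact mul_le_mul_of_nonneg_right (by nlinarith) hw
  have h0 := tendsto_zero_of_summable_div (fun k => (hbd k).1) hc0 hA' (by
    refine Summable.of_nonneg_of_le (fun k => ?_) (fun k => ?_)
      (h.summable_residual hmono hc0.le)
    · exact div_nonneg (hbd k).1 (by positivity)
    · rw [div_le_iff₀ (by positivity)]
      refine (hbd k).2.2.trans (le_of_eq ?_)
      rw [hT]; ring)
  refine squeeze_zero (fun k => by positivity) (fun k => (hbd k).2.1) ?_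
  simpa using h0.const_mul 2

/-- Convergence of the iterates to a common zero of `A`. -/
theorem tendsto_iterates [ProperSpace E] (h : DelayedTrajectory s γ τ w v y z D) {A : E → E}
    (hA : Continuous A) (hw : ∀ k, w k = A (y k)) (hne : ∃ x, A x = 0)
    (hmono : ∀ xs, A xs = 0 → ∀ k, (1 + τ) * ‖w k‖ ^ 2 ≤ inner ℝ (w k) (y k - xs)) :
    ∃ x, A x = 0 ∧ Tendsto z atTop (𝓝 x) ∧ Tendsto y atTop (𝓝 x) := by
  obtain ⟨x₀, hx₀⟩ := hne
  obtain ⟨M, hM⟩ := h.norm_anchor_bounded (hmono x₀ hx₀)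
  obtain ⟨x, -, φ, hφ, hx⟩ := (isCompact_closedBall x₀ M).tendsto_subseq
    (fun k => by simpa [dist_eq_norm] using hM k : ∀ k, z k ∈ Metric.closedBall x₀ M)
  have hζ := (h.tendsto_sub (hmono x₀ hx₀)).2
  have hyφ : Tendsto (fun k => y (φ k)) atTop (𝓝 x) := by
    have := hx.sub (hζ.comp hφ.tendsto_atTop)
    simpa using this
  have hw0 : Tendsto w atTop (𝓝 0) := by
    have h1 := (h.summable_residual (hmono x₀ hx₀) zero_le_one).tendsto_atTop_zero
    have h2 : Tendsto (fun k => ‖w k‖ ^ 2) atTop (𝓝 0) := by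
      refine squeeze_zero (fun k => sq_nonneg _) (fun k => ?_) h1
      exact le_mul_of_one_le_left (sq_nonneg _) (by linarith [Nat.cast_nonneg (α := ℝ) k])
    rw [tendsto_zero_iff_norm_tendsto_zero]
    simpa using h2.sqrt
  have hAx : A x = 0 := by
    have h1 := (hA.tendsto x).comp hyφ
    have h2 : Tendsto (fun k => A (y (φ k))) atTop (𝓝 0) := by
      simpa only [Function.comp_def, hw] using hw0.comp hφ.tendsto_atTop
    exact tendsto_nhds_unique h1 h2
  -- Opial's argument: the distance to the cluster point `x`, itself a zero, converges, and it tends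
  -- to zero along the subsequence.
  have hz : Tendsto z atTop (𝓝 x) := by
    obtain ⟨l, hl⟩ := h.exists_tendsto_anchor (hmono x hAx)
    have h1 : Tendsto (fun k => ‖z (φ k) - x‖ ^ 2) atTop (𝓝 0) := by
      simpa using ((hx.sub_const x).norm.pow 2)
    have h2 : l = 0 := tendsto_nhds_unique (hl.comp hφ.tendsto_atTop) h1
    rw [h2] at hl
    rw [tendsto_iff_norm_sub_tendsto_zero]
    simpa using hl.sqrt
  refine ⟨x, hAx, hz, ?_⟩
  simpa using hz.sub hζ

end DelayedTrajectory

/-! ### Delays and measurability of the three estimators. -/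

section Estimators

variable {n p : ℕ}

theorem norm_sq_sum_le {ι E : Type*} [SeminormedAddCommGroup E] (S : Finset ι) (f : ι → E) :
    ‖∑ i ∈ S, f i‖ ^ 2 ≤ S.card * ∑ i ∈ S, ‖f i‖ ^ 2 :=
  (pow_le_pow_left₀ (norm_nonneg _) (norm_sum_le _ _) 2).trans sq_sum_le_card_mul_sum_sq

theorem norm_sub_delay_sq_le {E : Type*} [SeminormedAddCommGroup E] (f : ℕ → E) {τ d : ℕ}
    (k : ℕ) (hd : d ≤ τ) :
    ‖f (k - d) - f k‖ ^ 2 ≤ τ * ∑ j ∈ Finset.range τ, ‖f (k - j) - f (k - j - 1)‖ ^ 2 := by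
  have h1 : f k - f (k - d) = ∑ j ∈ Finset.range d, (f (k - j) - f (k - j - 1)) := by
    have := Finset.sum_range_sub' (fun j => f (k - j)) d
    simp only [Nat.sub_zero] at this
    rw [← this]
    exact Finset.sum_congr rfl fun j _ => by rw [Nat.sub_sub]
  rw [norm_sub_rev, h1]
  refine (norm_sq_sum_le _ _).trans ?_
  rw [Finset.card_range]
  have h2 : ∑ j ∈ Finset.range d, ‖f (k - j) - f (k - j - 1)‖ ^ 2
      ≤ ∑ j ∈ Finset.range τ, ‖f (k - j) - f (k - j - 1)‖ ^ 2 :=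
    Finset.sum_le_sum_of_subset_of_nonneg (Finset.range_mono hd) fun _ _ _ => sq_nonneg _
  gcongr

/-- `l` is the last time at which entry `i` was refreshed, or `0` if there is none; the final clause
is what bounds the delay. -/
theorem exists_buffer_eq (G : Fin n → EuclideanSpace ℝ (Fin p) → EuclideanSpace ℝ (Fin p))
    (a : ℕ → Fin n) (y : ℕ → EuclideanSpace ℝ (Fin p)) (k : ℕ) (i : Fin n) :
    ∃ l ≤ k, buffer G a y k i = G i (y l) ∧ ∀ j, l < j → j ≤ k → a j ≠ i := by
  induction k with
  | zero => exact ⟨0, le_rfl, rfl, fun j h1 h2 => by omega⟩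
  | succ k ih =>
    by_cases h : i = a (k + 1)
    · exact ⟨k + 1, le_rfl, by rw [buffer, if_pos h], fun j h1 h2 => by omega⟩
    · obtain ⟨l, hl, hb, ha⟩ := ih
      refine ⟨l, by omega, by rw [buffer, if_neg h, hb], fun j h1 h2 => ?_⟩
      rcases Nat.lt_or_ge k j with h3 | h3
      · rw [show j = k + 1 by omega]
        exact fun h4 => h h4.symm
      · exact ha j h1 h3

theorem exists_buffer_delay
    (G : Fin n → EuclideanSpace ℝ (Fin p) → EuclideanSpace ℝ (Fin p))
    {a : ℕ → Fin n} {M : ℕ} (ha : ∀ i l, ∃ j, l < j ∧ j ≤ l + M ∧ a j = i)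
    (y : ℕ → EuclideanSpace ℝ (Fin p)) (k : ℕ) (i : Fin n) :
    ∃ d ≤ M, buffer G a y k i = G i (y (k - d)) := by
  obtain ⟨l, hl, hb, hne⟩ := exists_buffer_eq G a y k i
  refine ⟨k - l, ?_, by rw [hb, Nat.sub_sub_self hl]⟩
  obtain ⟨j, h1, h2, h3⟩ := ha i l
  by_contra hc
  exact hne j h1 (by omega) h3

theorem exists_cyclic_index [NeZero n] (i : Fin n) (l : ℕ) :
    ∃ j, l < j ∧ j ≤ l + n ∧ Fin.ofNat n j = i := by
  have hn := Nat.pos_of_ne_zero (NeZero.ne n)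
  have hi := i.isLt
  have h1 := Nat.mul_div_le (l + n - i) n
  have h2 := Nat.lt_mul_div_succ (l + n - i) hn
  rw [mul_add, mul_one] at h2
  -- The largest number up to `l + n` congruent to `i` modulo `n`.
  refine ⟨i + n * ((l + n - i) / n), by omega, by omega, ?_⟩
  ext
  rw [Fin.val_ofNat, Nat.add_mul_mod_self_left, Nat.mod_eq_of_lt hi]

/-- The index may already have been used in the current epoch, but it occurs in the next one, which
lies within the following `2n` iterations. -/
theorem exists_shuffled_index [NeZero n] (π : ℕ → Equiv.Perm (Fin n)) (i : Fin n) (l : ℕ) :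
    ∃ j, l < j ∧ j ≤ l + 2 * n ∧ π (j / n) (Fin.ofNat n j) = i := by
  have hn := Nat.pos_of_ne_zero (NeZero.ne n)
  set r := (π (l / n + 1)).symm i with hr
  have hri := r.isLt
  have h1 := Nat.mul_div_le l n
  have h2 := Nat.lt_mul_div_succ l hn
  have h3 : (r + n * (l / n + 1)) / n = l / n + 1 := by
    rw [Nat.add_mul_div_left _ _ hn, Nat.div_eq_of_lt hri, zero_add]
  have h4 : Fin.ofNat n (r + n * (l / n + 1)) = r := by
    ext
    rw [Fin.val_ofNat, Nat.add_mul_mod_self_left, Nat.mod_eq_of_lt hri]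
  refine ⟨r + n * (l / n + 1), by omega, ?_, ?_⟩
  · rw [mul_add, mul_one]; omega
  · rw [h3, h4, hr, Equiv.apply_symm_apply]

variable {Ω : Type*} [MeasurableSpace Ω]

theorem measurable_buffer {G : Fin n → EuclideanSpace ℝ (Fin p) → EuclideanSpace ℝ (Fin p)}
    (hG : ∀ i, Measurable (G i)) {a : ℕ → Ω → Fin n} (ha : ∀ j, Measurable (a j))
    {y : ℕ → Ω → EuclideanSpace ℝ (Fin p)} (k : ℕ) (hy : ∀ j ≤ k, Measurable (y j))
    (i : Fin n) :
    Measurable fun ω => buffer G (fun j => a j ω) (fun j => y j ω) k i := by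
  induction k with
  | zero => exact (hG i).comp (hy 0 le_rfl)
  | succ k ih =>
    simp only [buffer]
    refine Measurable.ite ?_ ((hG i).comp (hy _ le_rfl)) (ih fun j hj => hy j (by omega))
    exact measurableSet_eq_fun measurable_const (ha _)

/-- Each of the three estimators averages delayed evaluations and depends measurably on the
past iterates. -/
theorem estimator_delays [NeZero n]
    {G : Fin n → EuclideanSpace ℝ (Fin p) → EuclideanSpace ℝ (Fin p)}
    (hG : ∀ i, Measurable (G i)) {τ : ℕ} {y Gt : ℕ → Ω → EuclideanSpace ℝ (Fin p)}
    (h : IsInconsistentEstimator G τ y Gt ∨ (τ = n ∧ IsIncrementalEstimator G y Gt) ∨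
      (τ = 2 * n ∧ IsShufflingEstimator G y Gt)) :
    (∀ ω k, ∃ d : Fin n → ℕ, (∀ i, d i ≤ τ) ∧
      Gt k ω = (1 / (n : ℝ)) • ∑ i, G i (y (k - d i) ω)) ∧
    ∀ k, (∀ j ≤ k, Measurable (y j)) → Measurable (Gt k) := by
  rcases h with ⟨d, hdm, hd, hGt⟩ | ⟨rfl, hGt⟩ | ⟨rfl, π, hπ, hGt⟩
  · refine ⟨fun ω k => ⟨fun i => d i k ω, fun i => hd i k ω, hGt k ω⟩, fun k hy => ?_⟩
    rw [funext (hGt k)]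
    refine (Finset.measurable_sum _ fun i _ => (hG i).comp ?_).fun_const_smul _
    -- A random delay takes countably many values, so joint measurability in the delay and `ω`
    -- follows from that for each fixed delay.
    have h1 : Measurable fun q : ℕ × Ω => y (k - q.1) q.2 :=
      measurable_from_prod_countable_right fun m => hy _ (Nat.sub_le _ m)
    exact h1.comp ((hdm i k).prodMk measurable_id)
  · constructor
    · intro ω k
      -- These delays are chosen path by path; measurability comes from the recursion of the memory
      -- instead.
      choose d hd hb using exists_buffer_delay G exists_cyclic_index (fun j => y j ω) k
      exact ⟨d, hd, by rw [hGt]; simp only [hb]⟩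
    · intro k hy
      rw [funext (hGt k)]
      exact (Finset.measurable_sum _ fun i _ => measurable_buffer hG
        (a := fun j _ => Fin.ofNat _ j) (fun j => measurable_const) k hy i).fun_const_smul _
  · constructor
    · intro ω k
      choose d hd hb using exists_buffer_delay G
        (exists_shuffled_index fun m => π m ω) (fun j => y j ω) k
      exact ⟨d, hd, by rw [hGt]; simp only [hb]⟩
    · intro k hy
      rw [funext (hGt k)]
      exact (Finset.measurable_sum _ fun i _ => measurable_buffer hG
        (a := fun j ω => π (j / n) ω (Fin.ofNat n j)) (fun j => hπ _ _) k hy i).fun_const_smul _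

theorem IsAFP.measurable {s γ η : ℝ} {τ : ℕ} {y0 : EuclideanSpace ℝ (Fin p)}
    {Gt x y z : ℕ → Ω → EuclideanSpace ℝ (Fin p)} (h : IsAFP s γ η τ y0 Gt x y z)
    (hGt : ∀ k, (∀ j ≤ k, Measurable (y j)) → Measurable (Gt k)) (k : ℕ) :
    Measurable (y k) ∧ Measurable (z k) := by
  induction k using Nat.strong_induction_on with
  | _ k ih =>
    rcases k with _ | k
    · rw [funext h.y_zero, funext h.z_zero]
      exact ⟨measurable_const, measurable_const⟩
    · have hy : ∀ j ≤ k, Measurable (y j) := fun j hj => (ih j (by omega)).1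
      have hx : Measurable (x (k + 1)) := by
        rw [funext (h.x_succ k)]
        exact (hy k le_rfl).sub ((hGt k hy).fun_const_smul _)
      have hz : Measurable (z (k + 1)) := by
        rw [funext (h.z_succ k)]
        exact (ih k (by omega)).2.add ((hx.sub (hy k le_rfl)).fun_const_smul _)
      refine ⟨?_, hz⟩
      rw [funext (h.y_succ k)]
      exact (hx.fun_const_smul _).add (hz.fun_const_smul _)

end Estimators

/-! ### Co-coercivity, stepsizes and reduction to scaled trajectories. -/

namespace AvgCocoercive

variable {n p : ℕ} {G : Fin n → EuclideanSpace ℝ (Fin p) → EuclideanSpace ℝ (Fin p)} {β β' : ℝ}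

theorem norm_avgOp_sub_le (h : AvgCocoercive G β β') (hβ' : 0 ≤ β')
    (x y : EuclideanSpace ℝ (Fin p)) : β * ‖avgOp G x - avgOp G y‖ ≤ ‖x - y‖ := by
  have h1 := h x y
  have h2 := real_inner_le_norm (avgOp G x - avgOp G y) (x - y)
  have h3 : 0 ≤ β' / n * ∑ i, ‖G i x - G i y‖ ^ 2 := by positivity
  rcases (norm_nonneg (avgOp G x - avgOp G y)).eq_or_lt with h0 | h0
  · rw [← h0, mul_zero]; exact norm_nonneg _
  · refine le_of_mul_le_mul_left ?_ h0
    nlinarith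

theorem continuous_avgOp (h : AvgCocoercive G β β') (hβ : 0 < β) (hβ' : 0 ≤ β') :
    Continuous (avgOp G) := by
  refine (LipschitzWith.of_dist_le_mul (K := Real.toNNReal (1 / β)) fun x y => ?_).continuous
  rw [dist_eq_norm, dist_eq_norm, Real.coe_toNNReal _ (by positivity), one_div_mul_eq_div,
    le_div_iff₀ hβ, mul_comm]
  exact h.norm_avgOp_sub_le hβ' x y

/-- Needed for measurability of the estimators. The average is `1/β`-Lipschitz, which bounds the
inner product and with it each component increment. -/
theorem continuous_component [NeZero n] (h : AvgCocoercive G β β') (hβ : 0 < β) (hβ' : 0 < β')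
    (i : Fin n) : Continuous (G i) := by
  have hn : (0 : ℝ) < n := by exact_mod_cast Nat.pos_of_ne_zero (NeZero.ne n)
  refine (LipschitzWith.of_dist_le_mul (K := Real.toNNReal (Real.sqrt (n / (β' * β))))
    fun x y => ?_).continuous
  rw [dist_eq_norm, dist_eq_norm, Real.coe_toNNReal _ (Real.sqrt_nonneg _)]
  have h1 := h x y
  have h2 := real_inner_le_norm (avgOp G x - avgOp G y) (x - y)
  have h3 := h.norm_avgOp_sub_le hβ'.le x y
  have h4 : ‖G i x - G i y‖ ^ 2 ≤ ∑ i, ‖G i x - G i y‖ ^ 2 :=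
    Finset.single_le_sum (f := fun i => ‖G i x - G i y‖ ^ 2) (fun _ _ => sq_nonneg _)
      (Finset.mem_univ i)
  have h5 : β' / n * ‖G i x - G i y‖ ^ 2 ≤ β' / n * ∑ i, ‖G i x - G i y‖ ^ 2 := by gcongr
  have h6 : 0 ≤ β * ‖avgOp G x - avgOp G y‖ ^ 2 := by positivity
  have h7 : β' / n * ‖G i x - G i y‖ ^ 2 ≤ ‖x - y‖ / β * ‖x - y‖ := by
    have : ‖avgOp G x - avgOp G y‖ ≤ ‖x - y‖ / β := by rw [le_div_iff₀ hβ]; linarith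
    have := mul_le_mul_of_nonneg_right this (norm_nonneg (x - y))
    linarith
  refine le_of_sq_le_sq ?_ (by positivity)
  rw [mul_pow, Real.sq_sqrt (by positivity)]
  have h8 := mul_le_mul_of_nonneg_left h7 (by positivity : 0 ≤ (n : ℝ) / β')
  have e1 : (n : ℝ) / β' * (β' / n * ‖G i x - G i y‖ ^ 2) = ‖G i x - G i y‖ ^ 2 := by field_simp
  have e2 : (n : ℝ) / β' * (‖x - y‖ / β * ‖x - y‖) = n / (β' * β) * ‖x - y‖ ^ 2 := by
    field_simp
  rwa [e1, e2] at h8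

theorem scaled_inner_ge (h : AvgCocoercive G β β') {η c c' : ℝ} (hη : 0 < η) (hc : c * η ≤ β)
    (hc' : c' * η ≤ β') (x y : EuclideanSpace ℝ (Fin p)) :
    c * ‖η • avgOp G x - η • avgOp G y‖ ^ 2 + c' * (η ^ 2 / n * ∑ i, ‖G i x - G i y‖ ^ 2)
      ≤ inner ℝ (η • avgOp G x - η • avgOp G y) (x - y) := by
  rw [← smul_sub, inner_smul_left, norm_smul, Real.norm_of_nonneg hη.le, mul_pow, conj_trivial]
  have h1 := mul_le_mul_of_nonneg_left (h x y) hη.le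
  have h2 := mul_le_mul_of_nonneg_right hc
    (by positivity : 0 ≤ η * ‖avgOp G x - avgOp G y‖ ^ 2)
  have h3 := mul_le_mul_of_nonneg_right hc'
    (by positivity : 0 ≤ η / n * ∑ i, ‖G i x - G i y‖ ^ 2)
  calc _ = c * η * (η * ‖avgOp G x - avgOp G y‖ ^ 2)
        + c' * η * (η / n * ∑ i, ‖G i x - G i y‖ ^ 2) := by ring
    _ ≤ β * (η * ‖avgOp G x - avgOp G y‖ ^ 2)
        + β' * (η / n * ∑ i, ‖G i x - G i y‖ ^ 2) := by linarith
    _ = η * (β * ‖avgOp G x - avgOp G y‖ ^ 2 + β' / n * ∑ i, ‖G i x - G i y‖ ^ 2) := by ring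
    _ ≤ _ := h1

end AvgCocoercive

/-- In either regime `etaBar` is the smaller of its two expressions, because the threshold is where
they cross. -/
theorem stepsize_le_of_le_etaBar {s γ β β' η : ℝ} {τ : ℕ} (hΛ : 0 < 1 + s - γ) (hτ : 1 ≤ τ)
    (hη : η ≤ etaBar s γ β β' τ) :
    (1 + τ) * η ≤ β ∧ 7 / 3 * (1 + s - γ) * τ * η ≤ β' := by
  have hτ' : (0 : ℝ) < τ := by exact_mod_cast hτ
  unfold etaBar threshold LambdaPar at hη
  split_ifs at hη with h
  · rw [le_div_iff₀ (by positivity)] at h hη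
    refine ⟨?_, by linarith⟩
    refine le_of_mul_le_mul_left (a := 7 * (1 + s - γ) * τ) ?_ (by positivity)
    nlinarith
  · rw [not_le, div_lt_iff₀ (by positivity)] at h
    rw [le_div_iff₀ (by positivity)] at hη
    refine ⟨by linarith, ?_⟩
    refine le_of_mul_le_mul_right (a := 3 * (1 + (τ : ℝ))) ?_ (by positivity)
    have := mul_le_mul_of_nonneg_left hη (by positivity : 0 ≤ 7 * (1 + s - γ) * τ)
    nlinarith

/-- Every trajectory of the method with delayed evaluations is, after scaling, a
`DelayedTrajectory`. -/
theorem IsAFP.delayedTrajectory {Ω : Type*} {n p : ℕ} [NeZero n] {s γ η β β' : ℝ} {τ : ℕ}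
    {G : Fin n → EuclideanSpace ℝ (Fin p) → EuclideanSpace ℝ (Fin p)}
    {y0 : EuclideanSpace ℝ (Fin p)} {Gt x y z : ℕ → Ω → EuclideanSpace ℝ (Fin p)}
    (h : IsAFP s γ η τ y0 Gt x y z) (hγ0 : 0 < γ) (hγ1 : γ ≤ 1) (hs : 1 + 3 * γ ≤ s)
    (hτ : 1 ≤ τ) (hG : AvgCocoercive G β β') (hη : 0 < η) (hβ : (1 + τ) * η ≤ β)
    (hβ' : 7 / 3 * (1 + s - γ) * τ * η ≤ β') (ω : Ω)
    (hGt : ∀ k, ∃ d : Fin n → ℕ, (∀ i, d i ≤ τ) ∧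
      Gt k ω = (1 / (n : ℝ)) • ∑ i, G i (y (k - d i) ω)) :
    DelayedTrajectory s γ τ (fun k => η • avgOp G (y k ω)) (fun k => η • Gt k ω)
      (fun k => y k ω) (fun k => z k ω)
      (fun k => η ^ 2 / n * ∑ i, ‖G i (y k ω) - G i (y (k - 1) ω)‖ ^ 2) := by
  have hn : (0 : ℝ) < n := by exact_mod_cast Nat.pos_of_ne_zero (NeZero.ne n)
  have hs0 : 0 < s := by linarith
  have ht : ∀ k, 0 < tPar s τ k := fun k => by simp only [tPar]; positivity
  have hts : ∀ k, 0 < tPar s τ k - s := fun k => by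
    have : 0 < (k : ℝ) + 2 * s + τ := by positivity
    simp only [tPar]; linarith
  refine ⟨hγ0, hγ1, hs, hτ, by rw [h.y_zero, h.z_zero], fun k => ?_, fun k => ?_, fun k => ?_,
    fun k => ?_, by simp, fun k => by positivity, fun k => ?_⟩
  · have := (ht k).ne'; have := (hts k).ne'; have := hs0.ne'
    simp only [h.z_succ, h.x_succ, etaPar]
    match_scalars <;> field_simp
    ring
  · have := (ht k).ne'; have := (hts k).ne'; have := hs0.ne'
    simp only [h.y_succ, h.z_succ, h.x_succ, etaPar]
    match_scalars <;> field_simp <;> ring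
  · have := (ht k).ne'; have := (hts k).ne'; have := hs0.ne'
    simp only [h.y_succ, h.z_succ, h.x_succ, etaPar]
    match_scalars <;> field_simp <;> ring
  · exact hG.scaled_inner_ge hη hβ hβ' _ _
  · obtain ⟨d, hd, he⟩ := hGt k
    have e1 : η • Gt k ω - η • avgOp G (y k ω)
        = (η / n) • ∑ i, (G i (y (k - d i) ω) - G i (y k ω)) := by
      rw [he, avgOp, ← smul_sub, ← smul_sub, Finset.sum_sub_distrib, smul_smul, mul_one_div]
    rw [e1, norm_smul, mul_pow, Real.norm_of_nonneg (by positivity)]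
    have h1 := norm_sq_sum_le Finset.univ fun i => G i (y (k - d i) ω) - G i (y k ω)
    rw [Finset.card_univ, Fintype.card_fin] at h1
    have h2 : ∑ i, ‖G i (y (k - d i) ω) - G i (y k ω)‖ ^ 2
        ≤ ∑ i, τ * ∑ j ∈ Finset.range τ, ‖G i (y (k - j) ω) - G i (y (k - j - 1) ω)‖ ^ 2 :=
      Finset.sum_le_sum fun i _ => norm_sub_delay_sq_le (fun j => G i (y j ω)) k (hd i)
    rw [← Finset.mul_sum, Finset.sum_comm] at h2
    rw [← Finset.mul_sum]
    calc _ ≤ (η / n) ^ 2 * (n * (τ * ∑ j ∈ Finset.range τ,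
            ∑ i, ‖G i (y (k - j) ω) - G i (y (k - j - 1) ω)‖ ^ 2)) := by
          apply mul_le_mul_of_nonneg_left _ (by positivity)
          exact h1.trans (mul_le_mul_of_nonneg_left h2 hn.le)
      _ = _ := by field_simp

/-- Pathwise rate and convergence of the method with delayed evaluations. -/
theorem IsAFP.pathwise {Ω : Type*} {n p : ℕ} [NeZero n] {s γ η β β' : ℝ} {τ : ℕ}
    {G : Fin n → EuclideanSpace ℝ (Fin p) → EuclideanSpace ℝ (Fin p)}
    {y0 : EuclideanSpace ℝ (Fin p)} {Gt x y z : ℕ → Ω → EuclideanSpace ℝ (Fin p)}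
    (h : IsAFP s γ η τ y0 Gt x y z) (hγ0 : 0 < γ) (hγ1 : γ ≤ 1) (hs : 1 + 3 * γ ≤ s)
    (hτ : 1 ≤ τ) (hG : AvgCocoercive G β β') (hzer : ∃ x, avgOp G x = 0)
    (hη : 0 < η) (hβ : (1 + τ) * η ≤ β)
    (hβ' : 7 / 3 * (1 + s - γ) * τ * η ≤ β') (ω : Ω)
    (hGt : ∀ k, ∃ d : Fin n → ℕ, (∀ i, d i ≤ τ) ∧
      Gt k ω = (1 / (n : ℝ)) • ∑ i, G i (y (k - d i) ω)) :
    (∀ xs, avgOp G xs = 0 → ∀ k : ℕ, ‖avgOp G (y k ω)‖ ^ 2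
      ≤ 4 * initSq G s γ η τ y0 xs / (η * (k + 3 * s + τ - 1) ^ 2)) ∧
    (Summable fun k : ℕ => ((k : ℝ) + τ) * ‖avgOp G (y k ω)‖ ^ 2) ∧
    Tendsto (fun k : ℕ => ((k : ℝ) + τ) ^ 2 * ‖avgOp G (y k ω)‖ ^ 2) atTop (𝓝 0) ∧
    ∃ xl, avgOp G xl = 0 ∧ Tendsto (fun k => x k ω) atTop (𝓝 xl) ∧
      Tendsto (fun k => y k ω) atTop (𝓝 xl) ∧ Tendsto (fun k => z k ω) atTop (𝓝 xl) := by
  have hT := h.delayedTrajectory hγ0 hγ1 hs hτ hG hη hβ hβ' ω hGt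
  have hτ' : (1 : ℝ) ≤ τ := by exact_mod_cast hτ
  have hΛ : 0 < 1 + s - γ := by linarith
  have hβ0 : 0 < β := lt_of_lt_of_le (by positivity) hβ
  have hβ0' : 0 < β' := lt_of_lt_of_le (by positivity) hβ'
  have hmono : ∀ xs, avgOp G xs = 0 → ∀ k, (1 + τ) * ‖η • avgOp G (y k ω)‖ ^ 2
      ≤ inner ℝ (η • avgOp G (y k ω)) (y k ω - xs) := by
    intro xs hxs k
    have h1 := hG.scaled_inner_ge (c' := 0) hη hβ (by linarith) (y k ω) xs
    simpa [hxs] using h1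
  have hsq : ∀ k, ‖avgOp G (y k ω)‖ ^ 2 = (1 / η ^ 2) * ‖η • avgOp G (y k ω)‖ ^ 2 := fun k => by
    rw [norm_smul, mul_pow, Real.norm_of_nonneg hη.le]; field_simp
  obtain ⟨x₀, hx₀⟩ := hzer
  refine ⟨fun xs hxs k => ?_, ?_, ?_, ?_⟩
  · have h1 := hT.residual_le (hmono xs hxs) k
    have h2 := (hT.params k).sub_one_pos
    have h3 : (k : ℝ) + 3 * s + τ - 1 = tPar s τ k - 1 := rfl
    rw [h.y_zero, norm_smul, norm_smul, mul_pow, mul_pow, Real.norm_of_nonneg hη.le] at h1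
    rw [h3, le_div_iff₀ (by positivity)]
    refine le_of_mul_le_mul_left (a := η) ?_ hη
    have h4 : η * (4 * initSq G s γ η τ y0 xs)
        = 4 * (1 / 2 * ((3 * s + τ - 1) ^ 2 * (η ^ 2 * ‖avgOp G y0‖ ^ 2))
          + 2 * s ^ 3 / γ * ‖y0 - xs‖ ^ 2) := by
      rw [initSq]; field_simp
    rw [h4]
    linarith
  · simp only [hsq]
    refine ((hT.summable_residual (hmono x₀ hx₀) (c := τ) (by linarith)).mul_left
      (1 / η ^ 2)).congr fun k => ?_
    ring
  · have h1 := (hT.tendsto_sq_mul_residual (hmono x₀ hx₀)).const_mul (1 / η ^ 2)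
    rw [mul_zero] at h1
    refine squeeze_zero (fun k => by positivity) (fun k => ?_) h1
    have h2 : ((k : ℝ) + τ) ^ 2 ≤ (tPar s τ k - 1) ^ 2 :=
      pow_le_pow_left₀ (by positivity) (by simp only [tPar]; linarith) 2
    rw [hsq, mul_left_comm]
    gcongr
  · obtain ⟨xl, hxl, hz, hy⟩ := hT.tendsto_iterates (A := fun a => η • avgOp G a)
      ((hG.continuous_avgOp hβ0 hβ0'.le).const_smul η) (fun k => rfl) ⟨x₀, by simp [hx₀]⟩
      (fun xs hxs => hmono xs ((smul_eq_zero.1 hxs).resolve_left hη.ne'))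
    refine ⟨xl, (smul_eq_zero.1 hxl).resolve_left hη.ne', ?_, hy, hz⟩
    -- `x 0` is arbitrary. Each later `x` differs from the preceding `y` by at most the norm of the
    -- scaled estimator, since `t ≤ 2 (t - s)`.
    rw [← tendsto_add_atTop_iff_nat 1]
    have hv := hT.tendsto_estimator (hmono x₀ hx₀)
    have hx : ∀ k, x (k + 1) ω = y k ω
        - (tPar s τ k / (2 * (tPar s τ k - s))) • (η • Gt k ω) := fun k => by
      rw [h.x_succ, etaPar, smul_smul]; congr 2; ring
    simp only [hx]
    have h1 : Tendsto (fun k => (tPar s τ k / (2 * (tPar s τ k - s))) • (η • Gt k ω))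
        atTop (𝓝 0) := by
      rw [tendsto_zero_iff_norm_tendsto_zero] at hv ⊢
      refine squeeze_zero (fun k => norm_nonneg _) (fun k => ?_) hv
      have hp := hT.params k
      have := hp.t_pos; have := hp.sub_s_pos; have := hp.three_s_le
      rw [norm_smul, Real.norm_of_nonneg (by positivity)]
      apply mul_le_of_le_one_left (norm_nonneg _)
      rw [div_le_one (by positivity)]
      linarith
    simpa using hy.sub h1

/-- Iteration count that makes an `O(1/k²)` bound smaller than `ε²`. -/
theorem exists_iteration_bound {n p : ℕ}
    {G : Fin n → EuclideanSpace ℝ (Fin p) → EuclideanSpace ℝ (Fin p)}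
    {s γ η b R ε : ℝ} {τ : ℕ} {y0 xs : EuclideanSpace ℝ (Fin p)} (hγ : 0 < γ) (hs : 1 ≤ s)
    (hΛ : 0 < 1 + s - γ) (hτ : 1 ≤ τ) (hη : 0 < η) (hb : 0 < b) (hε : 0 < ε)
    (hηb : 1 / η ≤ 7 / 3 * (1 + s - γ) * (τ / b))
    (hR : ‖avgOp G y0‖ ≤ R) (hR' : ‖y0 - xs‖ ≤ R) {f : ℕ → ℝ}
    (hf : ∀ k, f k ≤ 4 * initSq G s γ η τ y0 xs / (η * (k + 3 * s + τ - 1) ^ 2)) :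
    ∃ N : ℕ, (N : ℝ) ≤ (5 * s + (8 * s ^ 3 / γ + 1) * (7 / 3 * (1 + s - γ))) * R
        * (τ / ε + τ / (b * ε)) ∧ ∀ k ≥ N, f k ≤ ε ^ 2 := by
  have hτ' : (1 : ℝ) ≤ τ := by exact_mod_cast hτ
  have hR0 : 0 ≤ R := (norm_nonneg _).trans hR
  set c := 7 / 3 * (1 + s - γ) with hc
  have hc0 : 0 < c := by positivity
  set A := 8 * s ^ 3 / γ with hA
  have hA0 : 0 < A := by positivity
  set C := 5 * s + (A + 1) * c with hC
  have hC0 : 0 < C := by positivity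
  set B := C * R * (τ / ε + τ / (b * ε)) with hB
  have hB0 : 0 ≤ B := by positivity
  refine ⟨⌊B⌋₊, Nat.floor_le hB0, fun k hk => (hf k).trans ?_⟩
  have hkB : B < k + 1 := (Nat.lt_floor_add_one B).trans_le (by exact_mod_cast by omega)
  have hT : (k : ℝ) + 1 ≤ k + 3 * s + τ - 1 := by linarith
  set T := (k : ℝ) + 3 * s + τ - 1
  have hT0 : 0 < T := by have : (0 : ℝ) ≤ k := k.cast_nonneg; linarith
  have h1 : 4 * initSq G s γ η τ y0 xs / η
      = 2 * (3 * s + τ - 1) ^ 2 * ‖avgOp G y0‖ ^ 2 + A * (1 / η) ^ 2 * ‖y0 - xs‖ ^ 2 := by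
    rw [initSq, hA]; field_simp; ring
  have h2 : ‖avgOp G y0‖ ^ 2 ≤ R ^ 2 := pow_le_pow_left₀ (norm_nonneg _) hR 2
  have h3 : ‖y0 - xs‖ ^ 2 ≤ R ^ 2 := pow_le_pow_left₀ (norm_nonneg _) hR' 2
  have h4 : (1 / η) ^ 2 ≤ (c * (τ / b)) ^ 2 := pow_le_pow_left₀ (by positivity) hηb 2
  have h5 : (3 * s + τ - 1) ^ 2 ≤ (3 * s * τ) ^ 2 := by
    apply pow_le_pow_left₀ (by linarith)
    linear_combination mul_nonneg (by linarith : 0 ≤ 3 * s - 1) (by linarith : 0 ≤ (τ : ℝ) - 1)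
  have h6 : 4 * initSq G s γ η τ y0 xs / η ≤ (C * R * (τ + τ / b)) ^ 2 := by
    rw [h1]
    calc _ ≤ 2 * (3 * s * τ) ^ 2 * R ^ 2 + A * (c * (τ / b)) ^ 2 * R ^ 2 := by gcongr
      _ = R ^ 2 * (18 * s ^ 2 * τ ^ 2 + A * c ^ 2 * (τ / b) ^ 2) := by ring
      -- Both summands of `C` are used separately: `(5s)² ≥ 18 s²` and `(A + 1)² ≥ A`.
      _ ≤ R ^ 2 * (C ^ 2 * τ ^ 2 + C ^ 2 * (τ / b) ^ 2) := by
        have i1 : 18 * s ^ 2 ≤ C ^ 2 := by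
          have : (5 * s) ^ 2 ≤ C ^ 2 :=
            pow_le_pow_left₀ (by positivity) (by rw [hC]; exact le_add_of_nonneg_right (by positivity)) 2
          linear_combination this + 7 * sq_nonneg s
        have i2 : A * c ^ 2 ≤ C ^ 2 := by
          have : ((A + 1) * c) ^ 2 ≤ C ^ 2 :=
            pow_le_pow_left₀ (by positivity) (by rw [hC]; exact le_add_of_nonneg_left (by positivity)) 2
          have h0 : 0 ≤ (A ^ 2 + A + 1) * c ^ 2 := by positivity
          linear_combination this + h0
        gcongr
      _ ≤ R ^ 2 * (C ^ 2 * (τ + τ / b) ^ 2) := by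
        apply mul_le_mul_of_nonneg_left _ (sq_nonneg R)
        rw [← mul_add]
        apply mul_le_mul_of_nonneg_left _ (sq_nonneg C)
        have : 0 ≤ (τ : ℝ) * (τ / b) := by positivity
        linear_combination 2 * this
      _ = _ := by ring
  have h7 : C * R * (τ + τ / b) = B * ε := by rw [hB]; field_simp
  rw [h7] at h6
  rw [← div_div, div_le_iff₀ (by positivity), ← mul_pow]
  refine h6.trans (pow_le_pow_left₀ (by positivity) ?_ 2)
  rw [mul_comm]
  exact mul_le_mul_of_nonneg_left (by linarith) hε.le

theorem corollary3 (s γ : ℝ) (hγ0 : 0 < γ) (hγ1 : γ ≤ 1) (hs : 1 + 3 * γ ≤ s) :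
    -- the constant of the complexity bound depends on `s` and `γ` only
    ∃ C : ℝ, 0 < C ∧
    ∀ {Ω : Type*} [MeasurableSpace Ω] (P : Measure Ω) [IsProbabilityMeasure P]
      (n p : ℕ) [NeZero n]
      (G : Fin n → EuclideanSpace ℝ (Fin p) → EuclideanSpace ℝ (Fin p))
      (β β' : ℝ) (_hβ : 0 ≤ β) (_hβ' : 0 ≤ β') (_hG : AvgCocoercive G β β')
      (_hzer : ∃ x, avgOp G x = 0)
      (τ : ℕ) (_hτ : 1 ≤ τ)
      (η : ℝ) (_hη0 : 0 < η) (_hη : η ≤ etaBar s γ β β' τ)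
      (y0 : EuclideanSpace ℝ (Fin p))
      (Gt x y z : ℕ → Ω → EuclideanSpace ℝ (Fin p))
      (_hAFP : IsAFP s γ η τ y0 Gt x y z)
      (_hGt : IsInconsistentEstimator G τ y Gt ∨
        (τ = n ∧ IsIncrementalEstimator G y Gt) ∨
        (τ = 2 * n ∧ IsShufflingEstimator G y Gt)),
      -- (i) convergence in expectation
      ((∀ k, Integrable (fun ω => ‖avgOp G (y k ω)‖ ^ 2) P) ∧
        (∀ xs, avgOp G xs = 0 → ∀ k : ℕ,
          ∫ ω, ‖avgOp G (y k ω)‖ ^ 2 ∂P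
            ≤ 4 * initSq G s γ η τ y0 xs / (η * (k + 3 * s + τ - 1) ^ 2)) ∧
        Tendsto (fun k : ℕ => ((k : ℝ) + τ) ^ 2 * ∫ ω, ‖avgOp G (y k ω)‖ ^ 2 ∂P)
          atTop (𝓝 0)) ∧
      -- (ii) almost sure convergence
      ((∀ᵐ ω ∂P, Summable fun k : ℕ => ((k : ℝ) + τ) * ‖avgOp G (y k ω)‖ ^ 2) ∧
        (∀ᵐ ω ∂P, Tendsto (fun k : ℕ => ((k : ℝ) + τ) ^ 2 * ‖avgOp G (y k ω)‖ ^ 2)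
          atTop (𝓝 0)) ∧
        ∃ xlim : Ω → EuclideanSpace ℝ (Fin p), Measurable xlim ∧
          (∀ ω, avgOp G (xlim ω) = 0) ∧
          ∀ᵐ ω ∂P, Tendsto (fun k => x k ω) atTop (𝓝 (xlim ω)) ∧
            Tendsto (fun k => y k ω) atTop (𝓝 (xlim ω)) ∧
            Tendsto (fun k => z k ω) atTop (𝓝 (xlim ω))) ∧
      -- (iii) iteration complexity, for the largest admissible stepsize
      (η = etaBar s γ β β' τ →
        ∀ xs, avgOp G xs = 0 → ∀ R : ℝ, ‖avgOp G y0‖ ≤ R → ‖y0 - xs‖ ≤ R →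
        ∀ ε : ℝ, 0 < ε →
        (β' ≤ threshold s γ β τ →
          ∃ N : ℕ, (N : ℝ) ≤ C * R * (τ / ε + τ / (β' * ε)) ∧
            ∀ k ≥ N, ∫ ω, ‖avgOp G (y k ω)‖ ^ 2 ∂P ≤ ε ^ 2) ∧
        (threshold s γ β τ ≤ β' →
          ∃ N : ℕ, (N : ℝ) ≤ C * R * (τ / ε + τ / (β * ε)) ∧
            ∀ k ≥ N, ∫ ω, ‖avgOp G (y k ω)‖ ^ 2 ∂P ≤ ε ^ 2)) := by
  have hΛ : 0 < 1 + s - γ := by linarith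
  have hs1 : 1 ≤ s := by linarith
  refine ⟨5 * s + (8 * s ^ 3 / γ + 1) * (7 / 3 * (1 + s - γ)), by positivity, ?_⟩
  intro Ω _ P _ n p _ G β β' hβ hβ' hG hzer τ hτ η hη0 hη y0 Gt x y z hAFP hGt
  have hτ' : (1 : ℝ) ≤ τ := by exact_mod_cast hτ
  obtain ⟨hηβ, hηβ'⟩ := stepsize_le_of_le_etaBar hΛ hτ hη
  have hβ0 : 0 < β := lt_of_lt_of_le (by positivity) hηβ
  have hβ0' : 0 < β' := lt_of_lt_of_le (by positivity) hηβ'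
  obtain ⟨hdelay, hmeasG⟩ := estimator_delays
    (fun i => (hG.continuous_component hβ0 hβ0' i).measurable) hGt
  have hpath := fun ω => hAFP.pathwise hγ0 hγ1 hs hτ hG hzer hη0 hηβ hηβ' ω (hdelay ω)
  have hcont := hG.continuous_avgOp hβ0 hβ0'.le
  have hmeas := hAFP.measurable hmeasG
  have hmeasr : ∀ k, AEStronglyMeasurable (fun ω => ‖avgOp G (y k ω)‖ ^ 2) P := fun k =>
    ((hcont.measurable.comp (hmeas k).1).norm.pow_const 2).aestronglyMeasurable
  obtain ⟨x₀, hx₀⟩ := hzer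
  have hint : ∀ k, Integrable (fun ω => ‖avgOp G (y k ω)‖ ^ 2) P := fun k =>
    Integrable.of_bound (hmeasr k) _ (ae_of_all _ fun ω => by
      rw [Real.norm_of_nonneg (sq_nonneg _)]
      exact (hpath ω).1 x₀ hx₀ k)
  have hexp : ∀ xs, avgOp G xs = 0 → ∀ k : ℕ, ∫ ω, ‖avgOp G (y k ω)‖ ^ 2 ∂P
      ≤ 4 * initSq G s γ η τ y0 xs / (η * (k + 3 * s + τ - 1) ^ 2) := by
    intro xs hxs k
    have := integral_mono (hint k) (integrable_const _) fun ω => (hpath ω).1 xs hxs k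
    simpa using this
  refine ⟨⟨hint, hexp, ?_⟩, ⟨ae_of_all _ fun ω => (hpath ω).2.1,
    ae_of_all _ fun ω => (hpath ω).2.2.1, ?_⟩, ?_⟩
  · have hdom := tendsto_integral_of_dominated_convergence (μ := P)
      (F := fun (k : ℕ) ω => ((k : ℝ) + τ) ^ 2 * ‖avgOp G (y k ω)‖ ^ 2) (f := fun _ => 0)
      (fun _ => 4 * initSq G s γ η τ y0 x₀ / η) (fun k => (hmeasr k).const_mul _)
      (integrable_const _) (fun k => ae_of_all _ fun ω => by
        rw [Real.norm_of_nonneg (by positivity)]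
        have h1 := (hpath ω).1 x₀ hx₀ k
        have hk : (0 : ℝ) ≤ k := k.cast_nonneg
        have h2 : ((k : ℝ) + τ) ^ 2 ≤ (k + 3 * s + τ - 1) ^ 2 :=
          pow_le_pow_left₀ (by positivity) (by linarith) 2
        have h3 : 0 < (k : ℝ) + 3 * s + τ - 1 := by linarith
        rw [← div_div, le_div_iff₀ (by positivity)] at h1
        refine le_trans ?_ h1
        rw [mul_comm]
        exact mul_le_mul_of_nonneg_left h2 (sq_nonneg _))
      (ae_of_all _ fun ω => (hpath ω).2.2.1)
    simpa [integral_const_mul] using hdom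
  · choose xlim hzero hx hy hz using fun ω => (hpath ω).2.2.2
    exact ⟨xlim, measurable_of_tendsto_metrizable (fun k => (hmeas k).2)
      (tendsto_pi_nhds.2 hz), hzero, ae_of_all _ fun ω => ⟨hx ω, hy ω, hz ω⟩⟩
  · intro hηeq xs hxs R hR hR' ε hε
    have hτ0 : (0 : ℝ) < τ := by linarith
    have hsmall : threshold s γ β τ ≤ β' → η = β / (1 + τ) := by
      intro hle
      rw [hηeq, etaBar]
      split_ifs with h
      · rw [le_antisymm h hle, threshold, LambdaPar]
        have : 1 + (τ : ℝ) ≠ 0 := by positivity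
        field_simp
      · rfl
    constructor
    · intro hle
      rw [etaBar, if_pos hle, LambdaPar] at hηeq
      refine exists_iteration_bound hγ0 hs1 hΛ hτ hη0 hβ0' hε (le_of_eq ?_) hR hR'
        (hexp xs hxs)
      rw [hηeq]; field_simp
    · intro hle
      refine exists_iteration_bound hγ0 hs1 hΛ hτ hη0 hβ0 hε ?_ hR hR' (hexp xs hxs)
      -- The bound reduces to `1 + τ ≤ (7/3) Λ τ`, true because `Λ ≥ 2` and `τ ≥ 1`.
      rw [hsmall hle, one_div_div, mul_div_assoc', div_le_div_iff_of_pos_right hβ0]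
      nlinarith
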